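/- Notation. An $n$-qubit state is a non-zero vector of $(\mathbb C^2)^{\otimes n}$; $\propto$ means equality up to a non-zero complex scalar. The $n$-qubit Pauli group $\mathcal P_n$ consists of the operators $i^c\,\sigma_1\otimes\cdots\otimes\sigma_n$ with $\sigma_j\in\{I,X,Y,Z\}$ and $c\in\{0,1,2,3\}$; a Pauli operator is a Hermitian element of $\mathcal P_n$, and $M_P=(I+P)/2$ is the projector onto its $+1$ eigenspace. A Clifford unitary is a unitary $U$ with $U\mathcal P_nU^\dagger\subseteq\mathcal P_n$. For an $n$-qubit state $|\psi\rangle$ let $\mathrm{Stab}|\psi\rangle=\{P\in\mathcal P_n: P|\psi\rangle=|\psi\rangle\}$ and let $\nu(\psi)=n-\log_2|\mathrm{Stab}|\psi\rangle|$ be its stabilizer nullity; $|\psi\rangle$ is a stabilizer state if $|\mathrm{Stab}|\psi\rangle|=2^n$. A post-selected stabilizer circuit is a finite sequence of the following operations on a register of qubits: applying a Clifford unitary; measuring a Pauli operator $P$, post-selected on an outcome of non-zero probability (for outcome $+1$, $|\chi\rangle\mapsto M_P|\chi\rangle\neq 0$; outcome $-1$ of $P$ is outcome $+1$ of $-P$);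 adding ancilla qubits in a stabilizer state; and removing qubits that are in a product state with the remaining qubits. States are considered up to a non-zero scalar. Theorem. Let $m\le n$ and suppose that a post-selected stabilizer circuit with input an $n$-qubit state $|\psi_{\mathrm{in}}\rangle$ has output an $m$-qubit state $|\psi_{\mathrm{out}}\rangle$. Then $k=\nu(\psi_{\mathrm{in}})-\nu(\psi_{\mathrm{out}})$ is a non-negative integer, and there exist $k$ pairwise commuting $n$-qubit Pauli operators $P_1,\dots,P_k$ that are independent (no product of them over a non-empty set of indices is a multiple of the identity), an $n$-qubit Clifford unitary $C$, and an $(n-m)$-qubit stabilizer state $|S\rangle$ such that $$|\psi_{\mathrm{out}}\rangle\otimes|S\rangle\ \propto\ C\,M_{P_1}\cdots M_{P_k}\,|\psi_{\mathrm{in}}\rangle .$$ -/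

import Mathlib

noncomputable section

namespace StabCanon

open Matrix

/-- State vectors of an `n`-qubit register, in the computational basis (not normalized). -/
abbrev QState (n : ℕ) : Type := (Fin n → Fin 2) → ℂ

/-- Operators on an `n`-qubit register, in the computational basis. -/
abbrev QOp (n : ℕ) : Type := Matrix (Fin n → Fin 2) (Fin n → Fin 2) ℂ

/-- Equality of state vectors up to a non-zero scalar, `ψ ∝ φ`. -/
def Proportional {n : ℕ} (ψ φ : QState n) : Prop := ∃ a : ℂ, a ≠ 0 ∧ ψ = a • φ

/-- The tensor product of an `m`-qubit state (on the first qubits) and an `l`-qubit state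
(on the remaining ones), where `m + l = n`. -/
def tensor {m l n : ℕ} (h : m + l = n) (ψ : QState m) (φ : QState l) : QState n :=
  fun x => ψ (fun i => x (Fin.cast h (Fin.castAdd l i))) *
    φ (fun j => x (Fin.cast h (Fin.natAdd m j)))

/-- The one-qubit Pauli matrices `I`, `X`, `Y`, `Z`. -/
def pauliMat : Fin 4 → Matrix (Fin 2) (Fin 2) ℂ
  | 0 => 1
  | 1 => !![0, 1; 1, 0]
  | 2 => !![0, -Complex.I; Complex.I, 0]
  | 3 => !![1, 0; 0, -1]

/-- The tensor product of the one-qubit Pauli matrices `p 0`, …, `p (n - 1)`. -/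
def pauliString {n : ℕ} (p : Fin n → Fin 4) : QOp n :=
  Matrix.of fun x y => ∏ i, pauliMat (p i) (x i) (y i)

/-- The `n`-qubit Pauli group: tensor products of Pauli matrices with a phase in `{1, i, -1, -i}`. -/
def pauliGroup (n : ℕ) : Set (QOp n) :=
  {P | ∃ (c : Fin 4) (p : Fin n → Fin 4), P = Complex.I ^ (c : ℕ) • pauliString p}

/-- Pauli operators (observables): the Hermitian elements of the Pauli group, that is,
`± ` a tensor product of one-qubit Pauli matrices. -/
def IsPauliOperator {n : ℕ} (P : QOp n) : Prop := P ∈ pauliGroup n ∧ P.IsHermitian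

/-- Clifford unitaries: the unitaries that map the Pauli group to itself by conjugation. -/
def IsClifford {n : ℕ} (U : QOp n) : Prop :=
  U ∈ Matrix.unitaryGroup (Fin n → Fin 2) ℂ ∧ ∀ P ∈ pauliGroup n, U * P * Uᴴ ∈ pauliGroup n

/-- The stabilizer `Stab ψ`: the elements of the Pauli group having `ψ` as a `+1` eigenstate. -/
def stab {n : ℕ} (ψ : QState n) : Set (QOp n) := {P | P ∈ pauliGroup n ∧ P *ᵥ ψ = ψ}

/-- Stabilizer states: non-zero `n`-qubit states whose stabilizer has `2 ^ n` elements. -/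
def IsStabilizerState {n : ℕ} (ψ : QState n) : Prop := ψ ≠ 0 ∧ (stab ψ).ncard = 2 ^ n

/-- The stabilizer nullity `ν(ψ) = n - log₂ |Stab ψ|`. -/
def nullity {n : ℕ} (ψ : QState n) : ℝ := (n : ℝ) - Real.logb 2 ((stab ψ).ncard : ℝ)

/-- `M_P`: the projector onto the `+1` eigenspace of the Pauli operator `P`
(see `pauliProj_spec`). -/
def pauliProj {n : ℕ} (P : QOp n) : QOp n := (1 / 2 : ℂ) • (1 + P)

/-- Independence of commuting Pauli operators: no product over a non-empty subset is a multiple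
of the identity. -/
def PauliIndependent {n k : ℕ} (P : Fin k → QOp n) : Prop :=
  ∀ s : Finset (Fin k), s.Nonempty →
    ∀ a : ℂ, (List.ofFn fun i => if i ∈ s then P i else 1).prod ≠ a • (1 : QOp n)

/-- Post-selected stabilizer circuits with `n` input qubits and the given number of output qubits:
sequences of Clifford unitaries, Pauli measurements post-selected on the outcome `+1`
(the outcome `-1` of `P` is the outcome `+1` of `-P`), additions of ancilla qubits in a
stabilizer state, and removals of qubits. -/
inductive StabCircuit (n : ℕ) : ℕ → Type
  | idle : StabCircuit n n
  | clifford {m : ℕ} (c : StabCircuit n m) (U : QOp m) (hU : IsClifford U) : StabCircuit n m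
  | measure {m : ℕ} (c : StabCircuit n m) (P : QOp m) (hP : IsPauliOperator P) : StabCircuit n m
  | ancilla {m l : ℕ} (c : StabCircuit n m) (S : QState l) (hS : IsStabilizerState S) :
      StabCircuit n (m + l)
  | discard {m l : ℕ} (c : StabCircuit n (m + l)) : StabCircuit n m

/-- `c.Maps ψ φ`: the circuit `c` can take the pure state `ψ` to the pure state `φ`, as unnormalized
vectors. A post-selected outcome must have non-zero probability, and qubits can be removed only
if they are not entangled with the qubits that are kept (so that these are in a pure state). -/
def StabCircuit.Maps {n : ℕ} (ψ : QState n) : {m : ℕ} → StabCircuit n m → QState m → Prop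
  | _, .idle, φ => φ = ψ
  | _, .clifford c U _, φ => ∃ χ, c.Maps ψ χ ∧ φ = U *ᵥ χ
  | _, .measure c P _, φ => ∃ χ, c.Maps ψ χ ∧ φ = pauliProj P *ᵥ χ ∧ φ ≠ 0
  | _, .ancilla c S _, φ => ∃ χ, c.Maps ψ χ ∧ φ = tensor rfl χ S
  | _, .discard (l := l) c, φ => ∃ χ, c.Maps ψ χ ∧ ∃ ρ : QState l, χ = tensor rfl φ ρ

/-- The circuit `c` with input `ψ` has output `φ`, as states up to a non-zero scalar. -/
def StabCircuit.HasOutput {n m : ℕ} (c : StabCircuit n m) (ψ : QState n) (φ : QState m) : Prop :=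
  ∃ χ, c.Maps ψ χ ∧ Proportional φ χ

theorem pauliMat_mul_conjTranspose (a : Fin 4) : pauliMat a * (pauliMat a)ᴴ = 1 := by
  fin_cases a <;> ext i j <;> fin_cases i <;> fin_cases j <;>
    simp [pauliMat, Matrix.mul_apply, Fin.sum_univ_two]

theorem pauliString_mul_conjTranspose {n : ℕ} (p : Fin n → Fin 4) :
    pauliString p * (pauliString p)ᴴ = 1 := by
  ext x y
  have h : ∀ i, ∑ z, pauliMat (p i) (x i) z * star (pauliMat (p i) (y i) z)
      = if x i = y i then 1 else 0 := by
    intro i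
    have := congrFun (congrFun (pauliMat_mul_conjTranspose (p i)) (x i)) (y i)
    simpa [Matrix.mul_apply, Matrix.one_apply] using this
  have h2 : (pauliString p * (pauliString p)ᴴ) x y
      = ∏ i, ∑ z, pauliMat (p i) (x i) z * star (pauliMat (p i) (y i) z) := by
    rw [Finset.prod_univ_sum, Fintype.piFinset_univ]
    simp [Matrix.mul_apply, pauliString, Finset.prod_mul_distrib]
  rw [h2, Matrix.one_apply]
  simp only [h]
  by_cases hxy : x = y
  · simp [hxy]
  · obtain ⟨i, hi⟩ := Function.ne_iff.mp hxy
    rw [if_neg hxy]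
    exact Finset.prod_eq_zero (Finset.mem_univ i) (if_neg hi)

theorem IsPauliOperator.mul_self {n : ℕ} {P : QOp n} (hP : IsPauliOperator P) : P * P = 1 := by
  obtain ⟨⟨c, p, hc⟩, hH⟩ := hP
  have h1 : P * Pᴴ = 1 := by
    rw [hc, Matrix.conjTranspose_smul, Matrix.smul_mul, Matrix.mul_smul, smul_smul,
      pauliString_mul_conjTranspose, star_pow, ← mul_pow]
    simp
  rwa [hH.eq] at h1

/-- For a Pauli operator `P`, `pauliProj P` is the orthogonal projector onto the `+1` eigenspace. -/
theorem pauliProj_spec {n : ℕ} {P : QOp n} (hP : IsPauliOperator P) :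
    (pauliProj P).IsHermitian ∧ pauliProj P * pauliProj P = pauliProj P ∧
      ∀ ψ : QState n, P *ᵥ ψ = ψ ↔ pauliProj P *ᵥ ψ = ψ := by
  refine ⟨?_, ?_, fun ψ => ?_⟩
  · have := hP.2.eq
    simp [pauliProj, Matrix.IsHermitian, this]
  · have := hP.mul_self
    simp only [pauliProj, Matrix.smul_mul, Matrix.mul_smul, mul_add, add_mul, this,
      one_mul, mul_one]
    module
  · simp only [pauliProj, Matrix.smul_mulVec, Matrix.add_mulVec, Matrix.one_mulVec]
    constructor
    · intro h
      rw [h]; module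
    · intro h
      have h2 : P *ᵥ ψ = (2 : ℂ) • ((1 / 2 : ℂ) • (ψ + P *ᵥ ψ)) - ψ := by module
      rw [h2, h]; module

end StabCanon

end

noncomputable section

namespace StabCanon

open Matrix

/-! Suppose a Pauli `P` is measured on `φ` and some `Q` in `Stab φ` anticommutes with `P`. Since `Qφ
= φ`, the vector `M_P φ` is a multiple of `((P + Q)/√2) φ`, and `(P + Q)/√2` is Clifford. So only
measurements commuting with the current stabilizer matter (`exists_measuresTo_extends`). These leave
`|0⟩` ancillas alone, because a Pauli commuting with `Z` on a qubit acts there as `I` or `Z`; they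
can therefore all be performed on the input register. Discarding a qubit reduces to projecting it
onto `|0⟩` and forgetting the ancilla. Hence each operation preserves the invariant `Reaches`: up to
Cliffords, scalars and `|0⟩` ancillas, the current state is some `n`-qubit `χ` to which the input is
measured (`StabCircuit.Maps.reaches`).

The delicate point is that this equivalence is transitive, which requires ancillas to cancel: a
Clifford taking `ψ ⊗ |0⟩` to `φ ⊗ |0⟩` yields one taking `ψ` to `φ` (`exists_clifford_of_addZero`).
It can be corrected to commute with `Z` on the ancilla, by a Clifford that fixes `φ ⊗ |0⟩`
(`exists_clifford_transfer`).

Commuting measurements only enlarge the stabilizer. A basis of a complement of `Stab ψ` in `Stab χ`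
supplies the `k` operators, and the product of their projectors sends `ψ` to `χ` exactly
(`MeasuresTo.exists_pauliProj_prod`). As `m ≤ n`, `χ` is the output with ancillas attached, up to a
Clifford and a scalar (`Extends.exists_tensor_eq`). -/

/-! ### The Pauli group and its commutation relations. -/

/-- The tensor product of one-qubit operators. -/
def piMat {n : ℕ} (A : Fin n → Matrix (Fin 2) (Fin 2) ℂ) : QOp n :=
  Matrix.of fun x y => ∏ i, A i (x i) (y i)

theorem piMat_mul {n : ℕ} (A B : Fin n → Matrix (Fin 2) (Fin 2) ℂ) :
    piMat A * piMat B = piMat fun i => A i * B i := by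
  ext x y
  simp only [piMat, Matrix.mul_apply, Matrix.of_apply, ← Finset.prod_mul_distrib]
  rw [Finset.prod_univ_sum, Fintype.piFinset_univ]

theorem piMat_smul {n : ℕ} (c : Fin n → ℂ) (A : Fin n → Matrix (Fin 2) (Fin 2) ℂ) :
    (piMat fun i => c i • A i) = (∏ i, c i) • piMat A := by
  ext x y
  simp [piMat, Finset.prod_mul_distrib]

theorem piMat_one {n : ℕ} : (piMat fun _ => 1 : QOp n) = 1 := by
  ext x y
  simp only [piMat, Matrix.of_apply, Matrix.one_apply]
  rw [Finset.prod_ite_zero]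
  simp [funext_iff]

theorem pauliString_eq_piMat {n : ℕ} (p : Fin n → Fin 4) :
    pauliString p = piMat fun i => pauliMat (p i) := rfl

theorem pauliString_zero {n : ℕ} : pauliString (fun _ : Fin n => (0 : Fin 4)) = 1 := piMat_one

theorem pauliMat_conjTranspose (a : Fin 4) : (pauliMat a)ᴴ = pauliMat a := by
  fin_cases a <;> ext i j <;> fin_cases i <;> fin_cases j <;> simp [pauliMat]

theorem pauliString_conjTranspose {n : ℕ} (p : Fin n → Fin 4) :
    (pauliString p)ᴴ = pauliString p := by
  ext x y
  simp only [pauliString, Matrix.conjTranspose_apply, Matrix.of_apply, star_prod]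
  exact Finset.prod_congr rfl fun i _ =>
    congrFun (congrFun (pauliMat_conjTranspose (p i)) (x i)) (y i)

theorem pauliMat_mul (a b : Fin 4) :
    pauliMat a * pauliMat b =
      Complex.I ^ ((![![0, 0, 0, 0], ![0, 0, 1, 3], ![0, 3, 0, 1], ![0, 1, 3, 0]] :
        Fin 4 → Fin 4 → ℕ) a b) •
      pauliMat ((![![0, 1, 2, 3], ![1, 0, 3, 2], ![2, 3, 0, 1], ![3, 2, 1, 0]] :
        Fin 4 → Fin 4 → Fin 4) a b) := by
  fin_cases a <;> fin_cases b <;> ext i j <;> fin_cases i <;> fin_cases j <;>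
    simp [pauliMat, Matrix.mul_apply, Fin.sum_univ_two, Complex.I_pow_three]

/-- The sign `s` with `pauliMat a * pauliMat b = s • (pauliMat b * pauliMat a)`. -/
def pauliSign (a b : Fin 4) : ℂ := if a = 0 ∨ b = 0 ∨ a = b then 1 else -1

theorem pauliMat_mul_comm (a b : Fin 4) :
    pauliMat a * pauliMat b = pauliSign a b • (pauliMat b * pauliMat a) := by
  fin_cases a <;> fin_cases b <;> ext i j <;> fin_cases i <;> fin_cases j <;>
    simp [pauliSign, pauliMat, Matrix.mul_apply, Fin.sum_univ_two]

theorem pauliString_mul_comm {n : ℕ} (p q : Fin n → Fin 4) :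
    pauliString p * pauliString q =
      (∏ i, pauliSign (p i) (q i)) • (pauliString q * pauliString p) := by
  simp only [pauliString_eq_piMat, piMat_mul, ← piMat_smul, ← pauliMat_mul_comm]

theorem pauliSign_prod {n : ℕ} (p q : Fin n → Fin 4) :
    ∏ i, pauliSign (p i) (q i) = 1 ∨ ∏ i, pauliSign (p i) (q i) = -1 := by
  refine Finset.prod_induction _ (fun z : ℂ => z = 1 ∨ z = -1) ?_ (Or.inl rfl) ?_
  · rintro a b (rfl | rfl) (rfl | rfl) <;> simp
  · intro i _
    unfold pauliSign
    split_ifs <;> simp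

theorem mem_pauliGroup_iff {n : ℕ} {P : QOp n} :
    P ∈ pauliGroup n ↔ ∃ (k : ℕ) (p : Fin n → Fin 4), P = Complex.I ^ k • pauliString p := by
  constructor
  · rintro ⟨c, p, h⟩
    exact ⟨c, p, h⟩
  · rintro ⟨k, p, h⟩
    refine ⟨⟨k % 4, Nat.mod_lt _ (by norm_num)⟩, p, ?_⟩
    rw [h, Complex.I_pow_eq_pow_mod]

theorem pauliString_mem {n : ℕ} (p : Fin n → Fin 4) : pauliString p ∈ pauliGroup n :=
  mem_pauliGroup_iff.2 ⟨0, p, by simp⟩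

theorem one_mem_pauliGroup {n : ℕ} : (1 : QOp n) ∈ pauliGroup n :=
  mem_pauliGroup_iff.2 ⟨0, _, by rw [pauliString_zero]; simp⟩

theorem I_smul_mem_pauliGroup {n : ℕ} {P : QOp n} (hP : P ∈ pauliGroup n) :
    Complex.I • P ∈ pauliGroup n := by
  obtain ⟨k, p, rfl⟩ := mem_pauliGroup_iff.1 hP
  exact mem_pauliGroup_iff.2 ⟨k + 1, p, by rw [smul_smul, pow_succ']⟩

theorem neg_mem_pauliGroup {n : ℕ} {P : QOp n} (hP : P ∈ pauliGroup n) :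
    -P ∈ pauliGroup n := by
  have := I_smul_mem_pauliGroup (I_smul_mem_pauliGroup hP)
  rwa [smul_smul, Complex.I_mul_I, neg_one_smul] at this

theorem mul_mem_pauliGroup {n : ℕ} {P Q : QOp n} (hP : P ∈ pauliGroup n)
    (hQ : Q ∈ pauliGroup n) : P * Q ∈ pauliGroup n := by
  obtain ⟨k, p, rfl⟩ := mem_pauliGroup_iff.1 hP
  obtain ⟨l, q, rfl⟩ := mem_pauliGroup_iff.1 hQ
  rw [Matrix.smul_mul, Matrix.mul_smul, smul_smul, pauliString_eq_piMat, pauliString_eq_piMat,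
    piMat_mul]
  simp only [pauliMat_mul, piMat_smul]
  rw [smul_smul, Finset.prod_pow_eq_pow_sum, ← pow_add, ← pow_add, ← pauliString_eq_piMat]
  exact mem_pauliGroup_iff.2 ⟨_, _, rfl⟩

theorem mul_conjTranspose_of_mem_pauliGroup {n : ℕ} {P : QOp n} (hP : P ∈ pauliGroup n) :
    P * Pᴴ = 1 := by
  obtain ⟨k, p, rfl⟩ := mem_pauliGroup_iff.1 hP
  rw [Matrix.conjTranspose_smul, Matrix.smul_mul, Matrix.mul_smul, smul_smul,
    pauliString_mul_conjTranspose, star_pow, ← mul_pow]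
  simp

theorem conjTranspose_mul_of_mem_pauliGroup {n : ℕ} {P : QOp n} (hP : P ∈ pauliGroup n) :
    Pᴴ * P = 1 :=
  mul_eq_one_comm.1 (mul_conjTranspose_of_mem_pauliGroup hP)

theorem conjTranspose_eq_of_mem_pauliGroup {n : ℕ} {P : QOp n} (hP : P ∈ pauliGroup n) :
    Pᴴ = P ∨ Pᴴ = -P := by
  obtain ⟨c, p, rfl⟩ := hP
  rw [Matrix.conjTranspose_smul, pauliString_conjTranspose]
  fin_cases c <;> simp [Complex.I_pow_three]

theorem commute_or_of_mem_pauliGroup {n : ℕ} {P Q : QOp n} (hP : P ∈ pauliGroup n)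
    (hQ : Q ∈ pauliGroup n) : P * Q = Q * P ∨ P * Q = -(Q * P) := by
  obtain ⟨k, p, rfl⟩ := mem_pauliGroup_iff.1 hP
  obtain ⟨l, q, rfl⟩ := mem_pauliGroup_iff.1 hQ
  simp only [Matrix.smul_mul, Matrix.mul_smul]
  rw [pauliString_mul_comm]
  rcases pauliSign_prod p q with h | h <;> rw [h]
  · left; rw [one_smul, smul_comm]
  · right; rw [neg_one_smul, smul_neg, smul_neg, smul_comm]

theorem pauliGroup_finite (n : ℕ) : (pauliGroup n).Finite := by
  refine (Set.finite_range fun x : Fin 4 × (Fin n → Fin 4) =>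
    Complex.I ^ (x.1 : ℕ) • pauliString x.2).subset ?_
  rintro P ⟨c, p, rfl⟩
  exact ⟨(c, p), rfl⟩

/-- A non-scalar string has a non-identity factor at some site. A different non-identity Pauli
placed at that site alone produces exactly one sign. -/
theorem exists_anticommute {n : ℕ} {P : QOp n} (hP : P ∈ pauliGroup n)
    (h : ∀ a : ℂ, P ≠ a • 1) : ∃ R ∈ pauliGroup n, P * R = -(R * P) := by
  obtain ⟨k, p, rfl⟩ := mem_pauliGroup_iff.1 hP
  have : ∃ i, p i ≠ 0 := by
    by_contra! hp
    apply h (Complex.I ^ k)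
    rw [show p = fun _ => 0 from funext hp, pauliString_zero]
  obtain ⟨i, hi⟩ := this
  obtain ⟨b, hb⟩ : ∃ b, pauliSign (p i) b = -1 := by
    generalize p i = a at hi
    fin_cases a
    · exact absurd rfl hi
    · exact ⟨2, by simp [pauliSign]⟩
    · exact ⟨3, by simp [pauliSign]⟩
    · exact ⟨1, by simp [pauliSign]⟩
  refine ⟨_, pauliString_mem (Function.update (fun _ => 0) i b), ?_⟩
  rw [Matrix.smul_mul, Matrix.mul_smul, pauliString_mul_comm, Finset.prod_eq_single i]
  · rw [Function.update_self, hb, neg_one_smul, smul_neg]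
  · intro j _ hj
    rw [Function.update_of_ne hj]
    simp [pauliSign]
  · simp

theorem exists_hermitian_smul {n : ℕ} {R : QOp n} (hR : R ∈ pauliGroup n) :
    ∃ a : ℂ, IsPauliOperator (a • R) := by
  rcases conjTranspose_eq_of_mem_pauliGroup hR with h | h
  · exact ⟨1, by rw [one_smul]; exact ⟨hR, h⟩⟩
  · refine ⟨Complex.I, I_smul_mem_pauliGroup hR, ?_⟩
    rw [Matrix.IsHermitian, Matrix.conjTranspose_smul, h]
    simp

/-- Let `A` anticommute with `P` and `B` with `Q`. If neither serves for both, then `A` commutes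
with `Q` and `B` with `P`, so `A * B` does. A factor `1` or `i` makes the result Hermitian. -/
theorem exists_anticommute_both {n : ℕ} {P Q : QOp n} (hP : P ∈ pauliGroup n)
    (hQ : Q ∈ pauliGroup n) (hP' : ∀ a : ℂ, P ≠ a • 1) (hQ' : ∀ a : ℂ, Q ≠ a • 1) :
    ∃ R, IsPauliOperator R ∧ P * R = -(R * P) ∧ Q * R = -(R * Q) := by
  suffices ∃ R ∈ pauliGroup n, P * R = -(R * P) ∧ Q * R = -(R * Q) by
    obtain ⟨R, hR, h1, h2⟩ := this
    obtain ⟨a, ha⟩ := exists_hermitian_smul hR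
    exact ⟨a • R, ha, by rw [Matrix.mul_smul, Matrix.smul_mul, h1, smul_neg],
      by rw [Matrix.mul_smul, Matrix.smul_mul, h2, smul_neg]⟩
  obtain ⟨A, hA, hPA⟩ := exists_anticommute hP hP'
  obtain ⟨B, hB, hQB⟩ := exists_anticommute hQ hQ'
  rcases commute_or_of_mem_pauliGroup hQ hA with hQA | hQA
  · rcases commute_or_of_mem_pauliGroup hP hB with hPB | hPB
    · refine ⟨A * B, mul_mem_pauliGroup hA hB, ?_, ?_⟩
      · rw [← mul_assoc, hPA, neg_mul, mul_assoc, hPB, mul_assoc]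
      · rw [← mul_assoc, hQA, mul_assoc, hQB, mul_neg, mul_assoc]
    · exact ⟨B, hB, hPB, hQB⟩
  · exact ⟨A, hA, hPA, hQA⟩

/-! ### Clifford unitaries and the exchange of Pauli operators. -/

theorem IsClifford.conjTranspose_mul_self {n : ℕ} {U : QOp n} (hU : IsClifford U) :
    Uᴴ * U = 1 := Matrix.mem_unitaryGroup_iff'.1 hU.1

theorem IsClifford.mul_conjTranspose_self {n : ℕ} {U : QOp n} (hU : IsClifford U) :
    U * Uᴴ = 1 := Matrix.mem_unitaryGroup_iff.1 hU.1

theorem IsClifford.of_mem_pauliGroup {n : ℕ} {P : QOp n} (hP : P ∈ pauliGroup n) :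
    IsClifford P := by
  refine ⟨Matrix.mem_unitaryGroup_iff.2 (mul_conjTranspose_of_mem_pauliGroup hP), ?_⟩
  intro Q hQ
  have h1 := mul_conjTranspose_of_mem_pauliGroup hP
  rcases commute_or_of_mem_pauliGroup hP hQ with h | h
  · rwa [h, mul_assoc, h1, mul_one]
  · rw [h, neg_mul, mul_assoc, h1, mul_one]
    exact neg_mem_pauliGroup hQ

theorem IsClifford.one {n : ℕ} : IsClifford (1 : QOp n) :=
  .of_mem_pauliGroup one_mem_pauliGroup

theorem IsClifford.mul {n : ℕ} {U V : QOp n} (hU : IsClifford U) (hV : IsClifford V) :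
    IsClifford (U * V) := by
  refine ⟨mul_mem hU.1 hV.1, fun P hP => ?_⟩
  rw [Matrix.conjTranspose_mul]
  simpa only [mul_assoc] using hU.2 _ (hV.2 P hP)

theorem conj_cancel {n : ℕ} {U P : QOp n} (hU : Uᴴ * U = 1) : Uᴴ * (U * P * Uᴴ) * U = P := by
  calc Uᴴ * (U * P * Uᴴ) * U = (Uᴴ * U) * P * (Uᴴ * U) := by simp only [mul_assoc]
    _ = P := by rw [hU, one_mul, mul_one]

/-- Conjugation by `U` is an injective self-map of a finite set, hence onto, although the definition
only asks for an inclusion. -/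
theorem IsClifford.conjTranspose {n : ℕ} {U : QOp n} (hU : IsClifford U) : IsClifford Uᴴ := by
  refine ⟨Matrix.mem_unitaryGroup_iff.2 (by
    rw [Matrix.star_eq_conjTranspose, Matrix.conjTranspose_conjTranspose,
      hU.conjTranspose_mul_self]), ?_⟩
  intro P hP
  have hinj : Set.InjOn (fun P => U * P * Uᴴ) (pauliGroup n) := by
    intro P _ Q _ h
    have := congrArg (fun A => Uᴴ * A * U) h
    simpa only [conj_cancel hU.conjTranspose_mul_self] using this
  have himage : (fun P => U * P * Uᴴ) '' pauliGroup n = pauliGroup n :=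
    Set.eq_of_subset_of_ncard_le (Set.image_subset_iff.2 hU.2)
      hinj.ncard_image.ge (pauliGroup_finite n)
  obtain ⟨Q, hQ, rfl⟩ := himage.ge hP
  rw [Matrix.conjTranspose_conjTranspose, conj_cancel hU.conjTranspose_mul_self]
  exact hQ

/-- For anticommuting Pauli operators `P` and `Q`, the Clifford unitary `(P + Q) / √2`
that exchanges them. -/
def pauliSwap {n : ℕ} (P Q : QOp n) : QOp n := ((√2 : ℝ) : ℂ)⁻¹ • (P + Q)

theorem sqrt_two_inv_mul_self : ((√2 : ℝ) : ℂ)⁻¹ * ((√2 : ℝ) : ℂ)⁻¹ = 1 / 2 := by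
  rw [← mul_inv, ← Complex.ofReal_mul, Real.mul_self_sqrt (by norm_num)]
  norm_num

theorem pauliSwap_mul_self {n : ℕ} {P Q : QOp n} (hP : IsPauliOperator P)
    (hQ : IsPauliOperator Q) (h : P * Q = -(Q * P)) : pauliSwap P Q * pauliSwap P Q = 1 := by
  rw [pauliSwap, Matrix.smul_mul, Matrix.mul_smul, smul_smul, sqrt_two_inv_mul_self, add_mul,
    mul_add, mul_add, hP.mul_self, hQ.mul_self, h]
  module

theorem pauliSwap_isHermitian {n : ℕ} {P Q : QOp n} (hP : IsPauliOperator P)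
    (hQ : IsPauliOperator Q) : (pauliSwap P Q)ᴴ = pauliSwap P Q := by
  rw [pauliSwap, Matrix.conjTranspose_smul, Matrix.conjTranspose_add, hP.2.eq, hQ.2.eq]
  simp

theorem pauliSwap_comm {n : ℕ} (P Q : QOp n) : pauliSwap P Q = pauliSwap Q P := by
  rw [pauliSwap, pauliSwap, add_comm]

theorem pauliSwap_mul {n : ℕ} {P Q : QOp n} (hP : IsPauliOperator P) (hQ : IsPauliOperator Q) :
    pauliSwap P Q * P = Q * pauliSwap P Q := by
  rw [pauliSwap, Matrix.smul_mul, Matrix.mul_smul, add_mul, mul_add, hP.mul_self, hQ.mul_self,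
    add_comm]

theorem pauliSwap_isClifford {n : ℕ} {P Q : QOp n} (hP : IsPauliOperator P)
    (hQ : IsPauliOperator Q) (h : P * Q = -(Q * P)) : IsClifford (pauliSwap P Q) := by
  have hsq := pauliSwap_mul_self hP hQ h
  refine ⟨Matrix.mem_unitaryGroup_iff.2 (by
    rw [Matrix.star_eq_conjTranspose, pauliSwap_isHermitian hP hQ, hsq]), fun R hR => ?_⟩
  rw [pauliSwap_isHermitian hP hQ]
  -- The signs `s` and `t` are `±1`, so exactly one of the two terms survives and the conjugate is
  -- `±R` or `±R * (P * Q)`.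
  have key : ∀ s t : ℂ, P * R = s • (R * P) → Q * R = t • (R * Q) →
      pauliSwap P Q * R * pauliSwap P Q =
        (1 / 2 : ℂ) • ((s + t) • R + (s - t) • (R * (P * Q))) := by
    intro s t hs ht
    have e1 : (P + Q) * R = R * (s • P + t • Q) := by
      rw [add_mul, hs, ht, mul_add, Matrix.mul_smul, Matrix.mul_smul]
    have e2 : (s • P + t • Q) * (P + Q) = (s + t) • 1 + (s - t) • (P * Q) := by
      have h' : Q * P = -(P * Q) := by rw [h, neg_neg]
      rw [add_mul, mul_add, mul_add, Matrix.smul_mul, Matrix.smul_mul, Matrix.smul_mul,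
        Matrix.smul_mul, hP.mul_self, hQ.mul_self, h']
      module
    rw [pauliSwap, Matrix.smul_mul, Matrix.smul_mul, Matrix.mul_smul, smul_smul,
      sqrt_two_inv_mul_self, e1, mul_assoc, e2, mul_add, Matrix.mul_smul, Matrix.mul_smul, mul_one]
  have hPQ := mul_mem_pauliGroup hR (mul_mem_pauliGroup hP.1 hQ.1)
  rcases commute_or_of_mem_pauliGroup hP.1 hR with h1 | h1 <;>
    rcases commute_or_of_mem_pauliGroup hQ.1 hR with h2 | h2
  · rw [key 1 1 (by simpa using h1) (by simpa using h2)]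
    convert hR using 1
    module
  · rw [key 1 (-1) (by simpa using h1) (by simpa using h2)]
    convert hPQ using 1
    module
  · rw [key (-1) 1 (by simpa using h1) (by simpa using h2)]
    convert neg_mem_pauliGroup hPQ using 1
    module
  · rw [key (-1) (-1) (by simpa using h1) (by simpa using h2)]
    convert neg_mem_pauliGroup hR using 1
    module

/-- Clifford unitaries act transitively on the Pauli operators other than `± 1`, even when they
are required to fix the common `+1` eigenvectors of the two operators. -/
theorem exists_clifford_transfer {n : ℕ} {P Q : QOp n} (hP : IsPauliOperator P)
    (hQ : IsPauliOperator Q) (hP' : ∀ a : ℂ, P ≠ a • 1) (hQ' : ∀ a : ℂ, Q ≠ a • 1) :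
    ∃ D, IsClifford D ∧ D * P = Q * D ∧
      ∀ ψ : QState n, P *ᵥ ψ = ψ → Q *ᵥ ψ = ψ → D *ᵥ ψ = ψ := by
  obtain ⟨R, hR, hPR, hQR⟩ := exists_anticommute_both hP.1 hQ.1 hP' hQ'
  -- With `R` anticommuting with both, `P` is exchanged with `R` and then `R` with `Q`. This needs
  -- no relation between `P` and `Q`.
  refine ⟨pauliSwap Q R * pauliSwap P R,
    (pauliSwap_isClifford hQ hR hQR).mul (pauliSwap_isClifford hP hR hPR), ?_, ?_⟩
  · rw [mul_assoc, pauliSwap_mul hP hR, ← mul_assoc, pauliSwap_comm Q R, pauliSwap_mul hR hQ,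
      mul_assoc]
  · intro ψ h1 h2
    -- On a common `+1` eigenvector both swaps act as `(1 + R)/√2`, so the second one, an
    -- involution, undoes the first.
    have : pauliSwap P R *ᵥ ψ = pauliSwap Q R *ᵥ ψ := by
      simp only [pauliSwap, Matrix.smul_mulVec, Matrix.add_mulVec, h1, h2]
    rw [← Matrix.mulVec_mulVec, this, Matrix.mulVec_mulVec, pauliSwap_mul_self hQ hR hQR,
      Matrix.one_mulVec]

/-! ### Tensor products on a register split in two. -/

theorem sum_append {m l : ℕ} (f : (Fin (m + l) → Fin 2) → ℂ) :
    ∑ x, f x = ∑ u : Fin m → Fin 2, ∑ v : Fin l → Fin 2, f (Fin.append u v) := by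
  rw [← Fintype.sum_prod_type', ← (Fin.appendEquiv m l).sum_comp]
  rfl

theorem exists_eq_append {m l : ℕ} (x : Fin (m + l) → Fin 2) :
    ∃ (u : Fin m → Fin 2) (v : Fin l → Fin 2), x = Fin.append u v :=
  ⟨_, _, Fin.append_castAdd_natAdd.symm⟩

theorem append_inj {m l : ℕ} {u u' : Fin m → Fin 2} {v v' : Fin l → Fin 2} :
    Fin.append u v = Fin.append u' v' ↔ u = u' ∧ v = v' := by
  rw [← Prod.mk.injEq]
  exact (Fin.appendEquiv m l).injective.eq_iff (a := (u, v)) (b := (u', v'))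

theorem state_ext {m l : ℕ} {ψ φ : QState (m + l)}
    (h : ∀ u v, ψ (Fin.append u v) = φ (Fin.append u v)) : ψ = φ := by
  funext x
  obtain ⟨u, v, rfl⟩ := exists_eq_append x
  exact h u v

theorem op_ext {m l : ℕ} {A B : QOp (m + l)}
    (h : ∀ u v u' v', A (Fin.append u v) (Fin.append u' v') =
      B (Fin.append u v) (Fin.append u' v')) : A = B := by
  ext x y
  obtain ⟨u, v, rfl⟩ := exists_eq_append x
  obtain ⟨u', v', rfl⟩ := exists_eq_append y
  exact h u v u' v'

theorem tensor_append {m l : ℕ} (ψ : QState m) (φ : QState l) (u : Fin m → Fin 2)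
    (v : Fin l → Fin 2) : tensor rfl ψ φ (Fin.append u v) = ψ u * φ v := by
  simp [tensor]

/-- The tensor product of an operator on the first `m` qubits and one on the last `l` qubits. -/
def opTensor {m l : ℕ} (A : QOp m) (B : QOp l) : QOp (m + l) :=
  Matrix.of fun x y =>
    A (fun i => x (Fin.castAdd l i)) (fun i => y (Fin.castAdd l i)) *
      B (fun j => x (Fin.natAdd m j)) (fun j => y (Fin.natAdd m j))

theorem opTensor_append {m l : ℕ} (A : QOp m) (B : QOp l) (u u' : Fin m → Fin 2)
    (v v' : Fin l → Fin 2) :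
    opTensor A B (Fin.append u v) (Fin.append u' v') = A u u' * B v v' := by
  simp [opTensor]

theorem opTensor_mul {m l : ℕ} (A A' : QOp m) (B B' : QOp l) :
    opTensor A B * opTensor A' B' = opTensor (A * A') (B * B') := by
  refine op_ext fun u v u' v' => ?_
  rw [Matrix.mul_apply, sum_append, opTensor_append, Matrix.mul_apply, Matrix.mul_apply,
    Finset.sum_mul_sum]
  refine Finset.sum_congr rfl fun a _ => Finset.sum_congr rfl fun b _ => ?_
  rw [opTensor_append, opTensor_append]
  ring

theorem opTensor_mulVec {m l : ℕ} (A : QOp m) (B : QOp l) (ψ : QState m) (φ : QState l) :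
    opTensor A B *ᵥ tensor rfl ψ φ = tensor rfl (A *ᵥ ψ) (B *ᵥ φ) := by
  refine state_ext fun u v => ?_
  rw [tensor_append]
  simp only [Matrix.mulVec, dotProduct]
  rw [sum_append, Finset.sum_mul_sum]
  refine Finset.sum_congr rfl fun a _ => Finset.sum_congr rfl fun b _ => ?_
  rw [opTensor_append, tensor_append]
  ring

theorem opTensor_one {m l : ℕ} : opTensor (1 : QOp m) (1 : QOp l) = 1 := by
  refine op_ext fun u v u' v' => ?_
  rw [opTensor_append]
  simp only [Matrix.one_apply, append_inj]
  by_cases h1 : u = u' <;> by_cases h2 : v = v' <;> simp [h1, h2]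

theorem opTensor_conjTranspose {m l : ℕ} (A : QOp m) (B : QOp l) :
    (opTensor A B)ᴴ = opTensor Aᴴ Bᴴ := by
  ext x y
  simp [opTensor]

theorem opTensor_smul_left {m l : ℕ} (a : ℂ) (A : QOp m) (B : QOp l) :
    opTensor (a • A) B = a • opTensor A B := by
  ext x y
  simp [opTensor, mul_assoc]

theorem opTensor_smul_right {m l : ℕ} (a : ℂ) (A : QOp m) (B : QOp l) :
    opTensor A (a • B) = a • opTensor A B := by
  ext x y
  simp [opTensor, mul_left_comm]

theorem opTensor_pauliString {m l : ℕ} (p : Fin m → Fin 4) (q : Fin l → Fin 4) :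
    opTensor (pauliString p) (pauliString q) = pauliString (Fin.append p q) := by
  ext x y
  simp [opTensor, pauliString, Fin.prod_univ_add]

theorem opTensor_mem_pauliGroup {m l : ℕ} {P : QOp m} {Q : QOp l} (hP : P ∈ pauliGroup m)
    (hQ : Q ∈ pauliGroup l) : opTensor P Q ∈ pauliGroup (m + l) := by
  obtain ⟨j, p, rfl⟩ := mem_pauliGroup_iff.1 hP
  obtain ⟨k, q, rfl⟩ := mem_pauliGroup_iff.1 hQ
  rw [opTensor_smul_left, opTensor_smul_right, smul_smul, ← pow_add, opTensor_pauliString]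
  exact mem_pauliGroup_iff.2 ⟨_, _, rfl⟩

theorem exists_eq_opTensor {m l : ℕ} {P : QOp (m + l)} (hP : P ∈ pauliGroup (m + l)) :
    ∃ Q ∈ pauliGroup m, ∃ q : Fin l → Fin 4, P = opTensor Q (pauliString q) := by
  obtain ⟨k, p, rfl⟩ := mem_pauliGroup_iff.1 hP
  refine ⟨_, mem_pauliGroup_iff.2 ⟨k, fun i => p (Fin.castAdd l i), rfl⟩,
    fun j => p (Fin.natAdd m j), ?_⟩
  rw [opTensor_smul_left, opTensor_pauliString, Fin.append_castAdd_natAdd]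

theorem isPauliOperator_opTensor {m l : ℕ} {P : QOp m} {Q : QOp l} (hP : IsPauliOperator P)
    (hQ : IsPauliOperator Q) : IsPauliOperator (opTensor P Q) :=
  ⟨opTensor_mem_pauliGroup hP.1 hQ.1, by
    rw [Matrix.IsHermitian, opTensor_conjTranspose, hP.2.eq, hQ.2.eq]⟩

theorem isPauliOperator_pauliString {n : ℕ} (p : Fin n → Fin 4) :
    IsPauliOperator (pauliString p) :=
  ⟨pauliString_mem p, pauliString_conjTranspose p⟩

theorem IsPauliOperator.one {n : ℕ} : IsPauliOperator (1 : QOp n) :=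
  ⟨one_mem_pauliGroup, Matrix.isHermitian_one⟩

theorem isClifford_opTensor {m l : ℕ} {U : QOp m} {V : QOp l} (hU : IsClifford U)
    (hV : IsClifford V) : IsClifford (opTensor U V) := by
  refine ⟨Matrix.mem_unitaryGroup_iff.2 ?_, fun P hP => ?_⟩
  · rw [Matrix.star_eq_conjTranspose, opTensor_conjTranspose, opTensor_mul,
      hU.mul_conjTranspose_self, hV.mul_conjTranspose_self, opTensor_one]
  · obtain ⟨Q, hQ, q, rfl⟩ := exists_eq_opTensor hP
    rw [opTensor_conjTranspose, opTensor_mul, opTensor_mul]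
    exact opTensor_mem_pauliGroup (hU.2 _ hQ) (hV.2 _ (pauliString_mem q))

/-! ### Ancilla qubits in the state `|0⟩` and their cancellation. -/

/-- The Pauli operator `Z` on the last qubit. -/
def zLast (n : ℕ) : QOp (n + 1) := opTensor 1 (pauliString fun _ => 3)

theorem zLast_isPauliOperator (n : ℕ) : IsPauliOperator (zLast n) :=
  isPauliOperator_opTensor .one (isPauliOperator_pauliString _)

/-- The isometry that appends a qubit in the state `|0⟩`. -/
def zeroIsometry (n : ℕ) : Matrix (Fin (n + 1) → Fin 2) (Fin n → Fin 2) ℂ :=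
  Matrix.of fun x y => if x = Fin.append y (0 : Fin 1 → Fin 2) then 1 else 0

theorem zeroIsometry_append {n : ℕ} (u : Fin n → Fin 2) (v : Fin 1 → Fin 2)
    (y : Fin n → Fin 2) :
    zeroIsometry n (Fin.append u v) y = (if u = y then 1 else 0) * (if v = 0 then 1 else 0) := by
  simp only [zeroIsometry, Matrix.of_apply, append_inj]
  by_cases h1 : u = y <;> by_cases h2 : v = 0 <;> simp [h1, h2]

theorem zeroIsometry_conjTranspose_mul_self (n : ℕ) :
    (zeroIsometry n)ᴴ * zeroIsometry n = 1 := by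
  ext u u'
  rw [Matrix.mul_apply, sum_append]
  simp only [Matrix.conjTranspose_apply, zeroIsometry_append]
  simp [Matrix.one_apply, eq_comm]

theorem opTensor_mul_zeroIsometry {n : ℕ} (A : QOp n) {B : QOp 1}
    (hB : ∀ v, B v 0 = if v = 0 then 1 else 0) :
    opTensor A B * zeroIsometry n = zeroIsometry n * A := by
  ext x y
  obtain ⟨u, v, rfl⟩ := exists_eq_append x
  rw [Matrix.mul_apply, sum_append, Matrix.mul_apply]
  simp only [opTensor_append, zeroIsometry_append]
  simp [hB, mul_comm]

theorem fin_one_fun_eq (v : Fin 1 → Fin 2) : v = 0 ∨ v = 1 := by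
  revert v; decide

theorem one_ne_zero_fun : (1 : Fin 1 → Fin 2) ≠ 0 := by decide

theorem pauliString_one_apply (a : Fin 4) (v w : Fin 1 → Fin 2) :
    pauliString (fun _ => a) v w = pauliMat a (v 0) (w 0) := by
  simp [pauliString]

theorem zeroIsometry_mul_conjTranspose (n : ℕ) :
    zeroIsometry n * (zeroIsometry n)ᴴ = pauliProj (zLast n) := by
  refine op_ext fun u v u' v' => ?_
  rw [Matrix.mul_apply, pauliProj, ← opTensor_one, zLast]
  simp only [Matrix.conjTranspose_apply, zeroIsometry_append, Matrix.smul_apply, Matrix.add_apply,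
    opTensor_append, pauliString_one_apply, Matrix.one_apply]
  rcases fin_one_fun_eq v with rfl | rfl <;> rcases fin_one_fun_eq v' with rfl | rfl <;>
    by_cases h : u = u' <;>
    simp [h, pauliMat, one_ne_zero_fun, one_ne_zero_fun.symm]
  all_goals norm_num

/-- The state `ψ ⊗ |0⟩`. -/
def addZero {n : ℕ} (ψ : QState n) : QState (n + 1) := zeroIsometry n *ᵥ ψ

theorem addZero_append {n : ℕ} (ψ : QState n) (u : Fin n → Fin 2) (v : Fin 1 → Fin 2) :
    addZero ψ (Fin.append u v) = if v = 0 then ψ u else 0 := by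
  simp [addZero, Matrix.mulVec, dotProduct, zeroIsometry_append]

theorem conjTranspose_mulVec_addZero {n : ℕ} (ψ : QState n) :
    (zeroIsometry n)ᴴ *ᵥ addZero ψ = ψ := by
  rw [addZero, Matrix.mulVec_mulVec, zeroIsometry_conjTranspose_mul_self, Matrix.one_mulVec]

theorem addZero_injective {n : ℕ} : Function.Injective (addZero (n := n)) := fun ψ φ h => by
  rw [← conjTranspose_mulVec_addZero ψ, h, conjTranspose_mulVec_addZero]

theorem addZero_smul {n : ℕ} (a : ℂ) (ψ : QState n) : addZero (a • ψ) = a • addZero ψ :=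
  Matrix.mulVec_smul _ _ _

theorem addZero_ne_zero {n : ℕ} {ψ : QState n} (h : ψ ≠ 0) : addZero ψ ≠ 0 := fun h0 =>
  h (addZero_injective (h0.trans (Matrix.mulVec_zero _).symm))

theorem pauliString_fix_zero {a : Fin 4} (ha : a = 0 ∨ a = 3) (v : Fin 1 → Fin 2) :
    pauliString (fun _ => a) v 0 = if v = 0 then 1 else 0 := by
  rcases ha with rfl | rfl <;> rcases fin_one_fun_eq v with rfl | rfl <;>
    simp [pauliString_one_apply, pauliMat, one_ne_zero_fun]

theorem opTensor_mulVec_addZero {n : ℕ} (A : QOp n) {a : Fin 4} (ha : a = 0 ∨ a = 3)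
    (ψ : QState n) :
    opTensor A (pauliString fun _ => a) *ᵥ addZero ψ = addZero (A *ᵥ ψ) := by
  rw [addZero, addZero, Matrix.mulVec_mulVec, Matrix.mulVec_mulVec,
    opTensor_mul_zeroIsometry A (pauliString_fix_zero ha)]

theorem opTensor_one_mulVec_addZero {n : ℕ} (A : QOp n) (ψ : QState n) :
    opTensor A (1 : QOp 1) *ᵥ addZero ψ = addZero (A *ᵥ ψ) := by
  rw [← pauliString_zero]
  exact opTensor_mulVec_addZero A (Or.inl rfl) ψ

theorem zLast_mulVec_addZero {n : ℕ} (ψ : QState n) : zLast n *ᵥ addZero ψ = addZero ψ := by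
  rw [zLast, opTensor_mulVec_addZero _ (Or.inr rfl), Matrix.one_mulVec]

/-- A state fixed by `Z` on the last qubit has the last qubit in the state `|0⟩`. -/
theorem exists_eq_addZero {n : ℕ} {ψ : QState (n + 1)} (h : zLast n *ᵥ ψ = ψ) :
    ∃ φ, ψ = addZero φ := by
  refine ⟨(zeroIsometry n)ᴴ *ᵥ ψ, ?_⟩
  rw [addZero, Matrix.mulVec_mulVec, zeroIsometry_mul_conjTranspose,
    ((pauliProj_spec (zLast_isPauliOperator n)).2.2 ψ).1 h]

theorem eq_zero_of_eq_neg {M : Type*} [AddCommGroup M] [Module ℂ M] {x : M} (h : x = -x) :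
    x = 0 := by
  have h2 : (2 : ℂ) • x = 0 := by
    rw [two_smul]
    nth_rewrite 2 [h]
    exact add_neg_cancel x
  exact (smul_eq_zero.1 h2).resolve_left two_ne_zero

/-- Pauli operators commuting with `Z` on the last qubit act on it as `1` or `Z`. -/
theorem exists_of_commute_zLast {n : ℕ} {P : QOp (n + 1)} (hP : P ∈ pauliGroup (n + 1))
    (h : P * zLast n = zLast n * P) : ∃ Q ∈ pauliGroup n, ∃ a : Fin 4, (a = 0 ∨ a = 3) ∧
      P = opTensor Q (pauliString fun _ => a) := by
  obtain ⟨Q, hQ, q, rfl⟩ := exists_eq_opTensor hP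
  obtain ⟨a, rfl⟩ : ∃ a, q = fun _ => a := ⟨q 0, by funext i; rw [Subsingleton.elim i 0]⟩
  refine ⟨Q, hQ, a, ?_, rfl⟩
  by_contra! ha
  rw [zLast, opTensor_mul, opTensor_mul, pauliString_mul_comm, mul_one, one_mul] at h
  have hs : pauliSign a 3 = -1 := by simp [pauliSign, ha]
  simp only [hs, Finset.prod_const, Finset.card_univ, Fintype.card_fin, pow_one] at h
  rw [neg_one_smul, ← neg_one_smul ℂ, opTensor_smul_right, neg_one_smul] at h
  -- If the last factor were `X` or `Y`, the product with `Z` would equal its own negative and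
  -- vanish, although Pauli group elements are unitary.
  have h0 := eq_zero_of_eq_neg h.symm
  have hmem := opTensor_mem_pauliGroup hQ
    (mul_mem_pauliGroup (pauliString_mem fun _ : Fin 1 => (3 : Fin 4)) (pauliString_mem fun _ => a))
  have := mul_conjTranspose_of_mem_pauliGroup hmem
  rw [h0, zero_mul] at this
  exact zero_ne_one this

theorem zLast_ne_smul_one {n : ℕ} (a : ℂ) : zLast n ≠ a • 1 := by
  intro h
  have h1 := congrFun (congrFun h (Fin.append 0 0)) (Fin.append 0 0)
  have h2 := congrFun (congrFun h (Fin.append 0 1)) (Fin.append 0 1)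
  simp only [zLast, opTensor_append, pauliString_one_apply, Matrix.smul_apply,
    Matrix.one_apply_eq] at h1 h2
  simp [pauliMat] at h1 h2
  rw [← h1] at h2
  norm_num at h2

/-- A Clifford unitary commuting with `Z` on the last qubit restricts to a Clifford unitary on the
other qubits when the last qubit is in the state `|0⟩`. -/
theorem IsClifford.restrict {n : ℕ} {C : QOp (n + 1)} (hC : IsClifford C)
    (h : C * zLast n = zLast n * C) :
    IsClifford ((zeroIsometry n)ᴴ * C * zeroIsometry n) := by
  set V := zeroIsometry n
  have hVV : Vᴴ * V = 1 := zeroIsometry_conjTranspose_mul_self n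
  have hproj : V * Vᴴ = pauliProj (zLast n) := zeroIsometry_mul_conjTranspose n
  -- `V * Vᴴ` is the projector `(1 + Z)/2`. Moving it past `Cᴴ` is what makes compression by `V`
  -- multiplicative here.
  have hcomm : V * Vᴴ * Cᴴ = Cᴴ * (V * Vᴴ) := by
    have h' : zLast n * Cᴴ = Cᴴ * zLast n := by
      calc zLast n * Cᴴ = Cᴴ * (C * zLast n) * Cᴴ := by
            rw [← mul_assoc, hC.conjTranspose_mul_self, one_mul]
        _ = Cᴴ * zLast n := by
            rw [h, mul_assoc, mul_assoc, hC.mul_conjTranspose_self, mul_one]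
    rw [hproj, pauliProj, Matrix.smul_mul, Matrix.mul_smul, add_mul, mul_add, h', one_mul, mul_one]
  have hconj : (Vᴴ * C * V)ᴴ = Vᴴ * Cᴴ * V := by
    simp only [Matrix.conjTranspose_mul, Matrix.conjTranspose_conjTranspose, Matrix.mul_assoc]
  refine ⟨Matrix.mem_unitaryGroup_iff.2 ?_, fun P hP => ?_⟩
  · rw [Matrix.star_eq_conjTranspose, hconj]
    calc Vᴴ * C * V * (Vᴴ * Cᴴ * V) = Vᴴ * C * (V * Vᴴ * Cᴴ) * V := by
          simp only [Matrix.mul_assoc]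
      _ = Vᴴ * (C * Cᴴ) * V * (Vᴴ * V) := by rw [hcomm]; simp only [Matrix.mul_assoc]
      _ = 1 := by rw [hC.mul_conjTranspose_self, hVV, Matrix.mul_one, Matrix.mul_one, hVV]
  -- The lift `R = P ⊗ 1` commutes with `Z` on the last qubit, and so does its conjugate by `C`.
  -- That conjugate is therefore `Q ⊗ I` or `Q ⊗ Z`, and its compression is `Q`.
  · obtain ⟨R, hR, hVR, hz⟩ : ∃ R ∈ pauliGroup (n + 1), R * V = V * P ∧
        R * zLast n = zLast n * R := by
      refine ⟨opTensor P (1 : QOp 1), opTensor_mem_pauliGroup hP one_mem_pauliGroup,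
        opTensor_mul_zeroIsometry P fun v => by rw [Matrix.one_apply], ?_⟩
      rw [zLast, opTensor_mul, opTensor_mul, mul_one, one_mul, mul_one, one_mul]
    have hCz : Cᴴ * zLast n = zLast n * Cᴴ := by
      calc Cᴴ * zLast n = Cᴴ * (zLast n * C) * Cᴴ := by
            rw [mul_assoc, mul_assoc, hC.mul_conjTranspose_self, mul_one]
        _ = zLast n * Cᴴ := by rw [← h, ← mul_assoc, hC.conjTranspose_mul_self, one_mul]
    obtain ⟨Q, hQ, a, ha, hQa⟩ := exists_of_commute_zLast (hC.2 _ hR) (by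
        rw [mul_assoc, hCz, ← mul_assoc, mul_assoc C, hz, ← mul_assoc, h, mul_assoc, mul_assoc,
          mul_assoc])
    convert hQ using 1
    rw [hconj]
    calc Vᴴ * C * V * P * (Vᴴ * Cᴴ * V) = Vᴴ * C * (V * P) * Vᴴ * Cᴴ * V := by
          simp only [Matrix.mul_assoc]
      _ = Vᴴ * C * R * (V * Vᴴ * Cᴴ) * V := by
          rw [← hVR]; simp only [Matrix.mul_assoc]
      _ = Vᴴ * (C * R * Cᴴ) * V * (Vᴴ * V) := by
          rw [hcomm]; simp only [Matrix.mul_assoc]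
      _ = Q := by
          rw [hQa, hVV, Matrix.mul_one, Matrix.mul_assoc,
            opTensor_mul_zeroIsometry Q (pauliString_fix_zero ha), ← Matrix.mul_assoc, hVV,
            Matrix.one_mul]

theorem IsPauliOperator.conj {n : ℕ} {U P : QOp n} (hU : IsClifford U) (hP : IsPauliOperator P) :
    IsPauliOperator (U * P * Uᴴ) := by
  refine ⟨hU.2 P hP.1, ?_⟩
  rw [Matrix.IsHermitian, Matrix.conjTranspose_mul, Matrix.conjTranspose_mul,
    Matrix.conjTranspose_conjTranspose, hP.2.eq, mul_assoc]

/-- Ancilla qubits in the state `|0⟩` cancel in Clifford equivalences. -/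
theorem exists_clifford_of_addZero {n : ℕ} {ψ φ : QState n} {C : QOp (n + 1)}
    (hC : IsClifford C) (h : C *ᵥ addZero ψ = addZero φ) :
    ∃ D : QOp n, IsClifford D ∧ D *ᵥ ψ = φ := by
  have hZ := zLast_isPauliOperator n
  have hP := IsPauliOperator.conj hC hZ
  have hfix : (C * zLast n * Cᴴ) *ᵥ addZero φ = addZero φ := by
    rw [← h, Matrix.mulVec_mulVec, mul_assoc, hC.conjTranspose_mul_self, mul_one,
      ← Matrix.mulVec_mulVec, zLast_mulVec_addZero]
  have hns : ∀ a : ℂ, C * zLast n * Cᴴ ≠ a • 1 := by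
    intro a ha
    apply zLast_ne_smul_one (n := n) a
    rw [← conj_cancel (P := zLast n) hC.conjTranspose_mul_self, ha, Matrix.mul_smul,
      Matrix.smul_mul, mul_one, hC.conjTranspose_mul_self]
  -- Both `Z` and its conjugate by `C` fix `addZero φ`, so `D` carries the conjugate back to `Z`
  -- without moving this state. Then `D * C` commutes with `Z` and restricts.
  obtain ⟨D, hD, hDP, hDfix⟩ := exists_clifford_transfer hP hZ hns zLast_ne_smul_one
  have hDC : D * C * zLast n = zLast n * (D * C) := by
    rw [← mul_assoc, ← hDP]
    simp only [mul_assoc, hC.conjTranspose_mul_self, mul_one]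
  refine ⟨_, (hD.mul hC).restrict hDC, ?_⟩
  rw [← Matrix.mulVec_mulVec, ← Matrix.mulVec_mulVec, ← Matrix.mulVec_mulVec]
  change (zeroIsometry n)ᴴ *ᵥ (D *ᵥ (C *ᵥ addZero ψ)) = φ
  rw [h, hDfix _ hfix (zLast_mulVec_addZero φ), conjTranspose_mulVec_addZero]

/-! ### Stabilizer groups of states. -/

theorem commute_of_mem_stab {n : ℕ} {ψ : QState n} (hψ : ψ ≠ 0) {P Q : QOp n}
    (hP : P ∈ stab ψ) (hQ : Q ∈ stab ψ) : P * Q = Q * P := by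
  refine (commute_or_of_mem_pauliGroup hP.1 hQ.1).resolve_right fun h => hψ ?_
  have h' := congrArg (fun A => A *ᵥ ψ) h
  simp only [Matrix.neg_mulVec, ← Matrix.mulVec_mulVec, hP.2, hQ.2] at h'
  exact eq_zero_of_eq_neg h'

/-- An anti-Hermitian element of the Pauli group squares to `-1`, and so has no eigenvalue `1`. -/
theorem isPauliOperator_of_mem_stab {n : ℕ} {ψ : QState n} (hψ : ψ ≠ 0) {P : QOp n}
    (hP : P ∈ stab ψ) : IsPauliOperator P := by
  refine ⟨hP.1, (conjTranspose_eq_of_mem_pauliGroup hP.1).resolve_right fun h => hψ ?_⟩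
  have h' := congrArg (fun A => A *ᵥ ψ) (conjTranspose_mul_of_mem_pauliGroup hP.1)
  simp only [h, Matrix.neg_mul, Matrix.neg_mulVec, ← Matrix.mulVec_mulVec, hP.2,
    Matrix.one_mulVec] at h'
  exact eq_zero_of_eq_neg h'.symm

theorem eq_one_of_mem_stab {n : ℕ} {ψ : QState n} (hψ : ψ ≠ 0) {P : QOp n} (hP : P ∈ stab ψ)
    {a : ℂ} (h : P = a • 1) : P = 1 := by
  have h' := hP.2
  rw [h, Matrix.smul_mulVec, Matrix.one_mulVec] at h'
  have : (a - 1) • ψ = 0 := by rw [sub_smul, h', one_smul, sub_self]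
  rw [h, sub_eq_zero.1 ((smul_eq_zero.1 this).resolve_right hψ), one_smul]

theorem mul_mem_stab {n : ℕ} {ψ : QState n} {P Q : QOp n} (hP : P ∈ stab ψ) (hQ : Q ∈ stab ψ) :
    P * Q ∈ stab ψ :=
  ⟨mul_mem_pauliGroup hP.1 hQ.1, by rw [← Matrix.mulVec_mulVec, hQ.2, hP.2]⟩

theorem one_mem_stab {n : ℕ} (ψ : QState n) : (1 : QOp n) ∈ stab ψ :=
  ⟨one_mem_pauliGroup, Matrix.one_mulVec ψ⟩

theorem stab_finite {n : ℕ} (ψ : QState n) : (stab ψ).Finite :=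
  (pauliGroup_finite n).subset fun _ h => h.1

theorem stab_smul {n : ℕ} (ψ : QState n) {a : ℂ} (ha : a ≠ 0) : stab (a • ψ) = stab ψ := by
  ext P
  simp only [stab, Set.mem_ofPred_eq, Matrix.mulVec_smul]
  rw [(smul_right_injective (QState n) ha).eq_iff]

theorem conj_mem_stab {n : ℕ} {ψ : QState n} {U P : QOp n} (hU : IsClifford U) (hP : P ∈ stab ψ) :
    U * P * Uᴴ ∈ stab (U *ᵥ ψ) := by
  refine ⟨hU.2 P hP.1, ?_⟩
  rw [Matrix.mulVec_mulVec, mul_assoc, hU.conjTranspose_mul_self, mul_one, ← Matrix.mulVec_mulVec,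
    hP.2]

theorem IsClifford.conjTranspose_mulVec_mulVec {n : ℕ} {U : QOp n} (hU : IsClifford U)
    (ψ : QState n) : Uᴴ *ᵥ (U *ᵥ ψ) = ψ := by
  rw [Matrix.mulVec_mulVec, hU.conjTranspose_mul_self, Matrix.one_mulVec]

theorem IsClifford.mulVec_conjTranspose_mulVec {n : ℕ} {U : QOp n} (hU : IsClifford U)
    (ψ : QState n) : U *ᵥ (Uᴴ *ᵥ ψ) = ψ := by
  rw [Matrix.mulVec_mulVec, hU.mul_conjTranspose_self, Matrix.one_mulVec]

theorem IsClifford.mulVec_ne_zero {n : ℕ} {U : QOp n} (hU : IsClifford U) {ψ : QState n}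
    (hψ : ψ ≠ 0) : U *ᵥ ψ ≠ 0 := fun h => hψ (by
  rw [← hU.conjTranspose_mulVec_mulVec ψ, h, Matrix.mulVec_zero])

theorem stab_clifford_ncard {n : ℕ} (ψ : QState n) {U : QOp n} (hU : IsClifford U) :
    (stab (U *ᵥ ψ)).ncard = (stab ψ).ncard := by
  have hle : ∀ (φ : QState n) {V : QOp n}, IsClifford V →
      (stab φ).ncard ≤ (stab (V *ᵥ φ)).ncard := by
    intro φ V hV
    refine Set.ncard_le_ncard_of_injOn (fun P => V * P * Vᴴ) (fun P => conj_mem_stab hV) ?_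
      (stab_finite _)
    intro P _ Q _ h
    have := congrArg (fun A => Vᴴ * A * V) h
    simpa only [conj_cancel hV.conjTranspose_mul_self] using this
  refine le_antisymm ?_ (hle ψ hU)
  have := hle (U *ᵥ ψ) hU.conjTranspose
  rwa [hU.conjTranspose_mulVec_mulVec] at this

theorem zLast_mem_stab {n : ℕ} (ψ : QState n) : zLast n ∈ stab (addZero ψ) :=
  ⟨(zLast_isPauliOperator n).1, zLast_mulVec_addZero ψ⟩

theorem opTensor_left_injective {n : ℕ} {A A' : QOp n} {a a' : Fin 4} (ha : a = 0 ∨ a = 3)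
    (ha' : a' = 0 ∨ a' = 3)
    (h : opTensor A (pauliString fun _ : Fin 1 => a) = opTensor A' (pauliString fun _ => a')) :
    A = A' := by
  have h' := congrArg (fun B => (zeroIsometry n)ᴴ * (B * zeroIsometry n)) h
  simpa only [opTensor_mul_zeroIsometry _ (pauliString_fix_zero ha),
    opTensor_mul_zeroIsometry _ (pauliString_fix_zero ha'), ← Matrix.mul_assoc,
    zeroIsometry_conjTranspose_mul_self, Matrix.one_mul] using h'

theorem opTensor_mem_stab_addZero {n : ℕ} {ψ : QState n} {Q : QOp n} (hQ : Q ∈ stab ψ) {a : Fin 4}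
    (ha : a = 0 ∨ a = 3) : opTensor Q (pauliString fun _ => a) ∈ stab (addZero ψ) :=
  ⟨opTensor_mem_pauliGroup hQ.1 (pauliString_mem _), by rw [opTensor_mulVec_addZero _ ha, hQ.2]⟩

theorem exists_of_mem_stab_addZero {n : ℕ} {ψ : QState n} (hψ : ψ ≠ 0) {P : QOp (n + 1)}
    (hP : P ∈ stab (addZero ψ)) : ∃ Q ∈ stab ψ, ∃ a : Fin 4, (a = 0 ∨ a = 3) ∧
      P = opTensor Q (pauliString fun _ => a) := by
  obtain ⟨Q, hQ, a, ha, rfl⟩ := exists_of_commute_zLast hP.1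
    (commute_of_mem_stab (addZero_ne_zero hψ) hP (zLast_mem_stab ψ))
  refine ⟨Q, ⟨hQ, addZero_injective ?_⟩, a, ha, rfl⟩
  rw [← opTensor_mulVec_addZero _ ha, hP.2]

/-- Stabilizer elements commute with `Z` on the ancilla, so the group is `Stab ψ` times `{I, Z}`.
The factor `2` offsets the extra qubit in the nullity. -/
theorem stab_addZero_ncard {n : ℕ} {ψ : QState n} (hψ : ψ ≠ 0) :
    (stab (addZero ψ)).ncard = 2 * (stab ψ).ncard := by
  have himage : stab (addZero ψ) = (fun x : QOp n × Fin 4 =>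
      opTensor x.1 (pauliString fun _ : Fin 1 => x.2)) '' (stab ψ ×ˢ {0, 3}) := by
    ext P
    constructor
    · intro hP
      obtain ⟨Q, hQ, a, ha, rfl⟩ := exists_of_mem_stab_addZero hψ hP
      exact ⟨(Q, a), ⟨hQ, ha⟩, rfl⟩
    · rintro ⟨⟨Q, a⟩, ⟨hQ, ha⟩, rfl⟩
      exact opTensor_mem_stab_addZero hQ ha
  have hne : ∀ Q ∈ stab ψ, opTensor Q (pauliString fun _ : Fin 1 => 0) ≠
      opTensor Q (pauliString fun _ : Fin 1 => 3) := by
    intro Q hQ h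
    have h' := congrArg (fun B => opTensor Qᴴ (1 : QOp 1) * B) h
    simp only [opTensor_mul, one_mul, conjTranspose_mul_of_mem_pauliGroup hQ.1, pauliString_zero,
      opTensor_one] at h'
    exact zLast_ne_smul_one (n := n) 1 (by rw [one_smul]; exact h'.symm)
  rw [himage, Set.InjOn.ncard_image, Set.ncard_prod, Set.ncard_pair (by decide), mul_comm]
  rintro ⟨Q, a⟩ ⟨hQ, ha⟩ ⟨Q', a'⟩ ⟨hQ', ha'⟩ h
  obtain rfl : Q = Q' := opTensor_left_injective ha ha' h
  rcases ha with rfl | rfl <;> rcases ha' with rfl | rfl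
  · rfl
  · exact absurd h (hne Q hQ)
  · exact absurd h.symm (hne Q hQ)
  · rfl

/-! ### Clifford equivalence up to ancilla qubits. -/

/-- `Extends ψ φ`: the state `φ` is obtained from `ψ` by Clifford unitaries, non-zero scalars and
additions of ancilla qubits in the state `|0⟩`. -/
inductive Extends {n : ℕ} (ψ : QState n) : ∀ {m : ℕ}, QState m → Prop
  | refl : Extends ψ ψ
  | clifford {m : ℕ} {φ : QState m} {U : QOp m} (h : Extends ψ φ) (hU : IsClifford U) :
      Extends ψ (U *ᵥ φ)
  | smul {m : ℕ} {φ : QState m} {a : ℂ} (h : Extends ψ φ) (ha : a ≠ 0) : Extends ψ (a • φ)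
  | addZero {m : ℕ} {φ : QState m} (h : Extends ψ φ) : Extends ψ (addZero φ)

theorem Extends.trans {n m l : ℕ} {ψ : QState n} {φ : QState m} {χ : QState l}
    (h : Extends ψ φ) (h' : Extends φ χ) : Extends ψ χ := by
  induction h' with
  | refl => exact h
  | clifford _ hU ih => exact ih.clifford hU
  | smul _ ha ih => exact ih.smul ha
  | addZero _ ih => exact ih.addZero

theorem Extends.ne_zero {n m : ℕ} {ψ : QState n} {φ : QState m} (h : Extends ψ φ) (hψ : ψ ≠ 0) :
    φ ≠ 0 := by
  induction h with
  | refl => exact hψ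
  | clifford _ hU ih => exact hU.mulVec_ne_zero ih
  | smul _ ha ih => exact smul_ne_zero ha ih
  | addZero _ ih => exact addZero_ne_zero ih

theorem Extends.le {n m : ℕ} {ψ : QState n} {φ : QState m} (h : Extends ψ φ) : n ≤ m := by
  induction h with
  | refl => exact le_rfl
  | clifford _ _ ih => exact ih
  | smul _ _ ih => exact ih
  | addZero _ ih => exact ih.trans (Nat.le_succ _)

theorem Extends.nullity_eq {n m : ℕ} {ψ : QState n} {φ : QState m} (h : Extends ψ φ)
    (hψ : ψ ≠ 0) : nullity φ = nullity ψ := by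
  induction h with
  | refl => rfl
  | clifford _ hU ih => rw [← ih, nullity, nullity, stab_clifford_ncard _ hU]
  | smul _ ha ih => rw [← ih, nullity, nullity, stab_smul _ ha]
  | @addZero m φ h ih =>
    rw [← ih, nullity, nullity, stab_addZero_ncard (h.ne_zero hψ)]
    have hpos : ((stab φ).ncard : ℝ) ≠ 0 :=
      Nat.cast_ne_zero.2 (Set.ncard_ne_zero_of_mem (one_mem_stab φ) (stab_finite φ))
    push_cast
    rw [Real.logb_mul two_ne_zero hpos, Real.logb_self_eq_one (by norm_num)]
    ring

/-- `LocallyEquiv ψ φ`: the states are equal up to a Clifford unitary and a non-zero scalar. -/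
inductive LocallyEquiv {n : ℕ} (ψ : QState n) : ∀ {m : ℕ}, QState m → Prop
  | mk {C : QOp n} (hC : IsClifford C) {a : ℂ} (ha : a ≠ 0) : LocallyEquiv ψ (a • C *ᵥ ψ)

theorem LocallyEquiv.extends {n m : ℕ} {ψ : QState n} {φ : QState m} (h : LocallyEquiv ψ φ) :
    Extends ψ φ := by
  cases h with
  | mk hC ha => exact (Extends.refl.clifford hC).smul ha

theorem LocallyEquiv.extends_symm {n m : ℕ} {ψ : QState n} {φ : QState m}
    (h : LocallyEquiv ψ φ) : Extends φ ψ := by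
  cases h with
  | @mk C hC a ha =>
    have h1 : Extends (a • C *ᵥ ψ) (Cᴴ *ᵥ (a⁻¹ • (a • C *ᵥ ψ))) :=
      (Extends.refl.smul (inv_ne_zero ha)).clifford hC.conjTranspose
    rwa [smul_smul, inv_mul_cancel₀ ha, one_smul, hC.conjTranspose_mulVec_mulVec] at h1

theorem LocallyEquiv.clifford {n m : ℕ} {ψ : QState n} {φ : QState m} (h : LocallyEquiv ψ φ)
    {U : QOp m} (hU : IsClifford U) : LocallyEquiv ψ (U *ᵥ φ) := by
  cases h with
  | mk hC ha =>
    rw [Matrix.mulVec_smul, Matrix.mulVec_mulVec]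
    exact .mk (hU.mul hC) ha

theorem LocallyEquiv.smul {n m : ℕ} {ψ : QState n} {φ : QState m} (h : LocallyEquiv ψ φ)
    {a : ℂ} (ha : a ≠ 0) : LocallyEquiv ψ (a • φ) := by
  cases h with
  | mk hC hb =>
    rw [smul_smul]
    exact .mk hC (mul_ne_zero ha hb)

theorem LocallyEquiv.refl {n : ℕ} (ψ : QState n) : LocallyEquiv ψ ψ := by
  simpa using LocallyEquiv.mk (ψ := ψ) .one one_ne_zero

theorem LocallyEquiv.exists_eq {n : ℕ} {ψ φ : QState n} (h : LocallyEquiv ψ φ) :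
    ∃ C, IsClifford C ∧ ∃ a : ℂ, a ≠ 0 ∧ φ = a • C *ᵥ ψ := by
  cases h with
  | mk hC ha => exact ⟨_, hC, _, ha, rfl⟩

theorem Extends.clifford_symm {n m : ℕ} {ψ : QState n} {φ : QState m} {U : QOp m}
    (h : Extends φ ψ) (hU : IsClifford U) : Extends (U *ᵥ φ) ψ := by
  have h1 := (Extends.refl (ψ := U *ᵥ φ)).clifford hU.conjTranspose
  rw [hU.conjTranspose_mulVec_mulVec] at h1
  exact h1.trans h

theorem Extends.smul_symm {n m : ℕ} {ψ : QState n} {φ : QState m} {a : ℂ}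
    (h : Extends φ ψ) (ha : a ≠ 0) : Extends (a • φ) ψ := by
  have h1 := (Extends.refl (ψ := a • φ)).smul (inv_ne_zero ha)
  rw [smul_smul, inv_mul_cancel₀ ha, one_smul] at h1
  exact h1.trans h

/-- Isolates the last ancilla added: what follows it is a Clifford and a scalar. If no ancilla was
added, every step is invertible. -/
theorem Extends.symm_or {n m : ℕ} {ψ : QState n} {φ : QState m} (h : Extends ψ φ) :
    Extends φ ψ ∨ ∃ (l : ℕ) (χ : QState l), Extends ψ χ ∧
      LocallyEquiv (StabCanon.addZero χ) φ := by
  induction h with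
  | refl => exact Or.inl .refl
  | clifford _ hU ih =>
    rcases ih with ih | ⟨l, χ, h1, h2⟩
    · exact Or.inl (ih.clifford_symm hU)
    · exact Or.inr ⟨l, χ, h1, h2.clifford hU⟩
  | smul _ ha ih =>
    rcases ih with ih | ⟨l, χ, h1, h2⟩
    · exact Or.inl (ih.smul_symm ha)
    · exact Or.inr ⟨l, χ, h1, h2.smul ha⟩
  | addZero h ih => exact Or.inr ⟨_, _, h, .refl _⟩

theorem Extends.symm {n : ℕ} {ψ φ : QState n} (h : Extends ψ φ) : Extends φ ψ := by
  refine h.symm_or.resolve_right ?_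
  rintro ⟨l, χ, h1, h2⟩
  have := h1.le
  have := h2.extends.le
  omega

theorem LocallyEquiv.cancel {n m l : ℕ} {ψ : QState n} {φ : QState m} {χ : QState l}
    (h : LocallyEquiv (addZero ψ) χ) (h' : LocallyEquiv (addZero φ) χ) : Extends ψ φ := by
  obtain rfl : n + 1 = l := le_antisymm h.extends.le h.extends_symm.le
  obtain ⟨rfl⟩ : m = n := by
    have := h'.extends.le
    have := h'.extends_symm.le
    omega
  obtain ⟨C, hC, a, ha, rfl⟩ := h.exists_eq
  obtain ⟨D, hD, b, hb, h2⟩ := h'.exists_eq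
  -- The scalars are absorbed into `φ`, since the cancellation lemma `exists_clifford_of_addZero`
  -- asks for an exact equality.
  have h3 : (Dᴴ * C) *ᵥ addZero ψ = addZero ((a⁻¹ * b) • φ) := by
    rw [← Matrix.mulVec_mulVec, addZero_smul, mul_smul,
      ← hD.conjTranspose_mulVec_mulVec (addZero φ), ← Matrix.mulVec_smul, ← Matrix.mulVec_smul,
      ← h2, smul_smul, inv_mul_cancel₀ ha, one_smul]
  obtain ⟨E, hE, h4⟩ := exists_clifford_of_addZero (hD.conjTranspose.mul hC) h3
  have h5 : φ = (a⁻¹ * b)⁻¹ • (E *ᵥ ψ) := by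
    rw [h4, smul_smul, inv_mul_cancel₀ (mul_ne_zero (inv_ne_zero ha) hb), one_smul]
  rw [h5]
  exact (Extends.refl.clifford hE).smul (inv_ne_zero (mul_ne_zero (inv_ne_zero ha) hb))

/-- Ancilla qubits cancel: two states with a common extension are extensions of each other. -/
theorem Extends.cancel {n m l : ℕ} {ψ : QState n} {φ : QState m} {χ : QState l}
    (hψ : Extends ψ χ) (hφ : Extends φ χ) (hmn : m ≤ n) : Extends φ ψ := by
  induction l using Nat.strong_induction_on with
  | _ l ih =>
    -- The last ancilla is stripped from both extensions, leaving a smaller common one. The mixed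
    -- case, where only `φ` has added none, is excluded by `m ≤ n`.
    rcases hψ.symm_or with h | ⟨k, ψ', h1, h2⟩
    · exact hφ.trans h
    · have hk := h1.le
      have hkl := h2.extends.le
      rcases hφ.symm_or with h' | ⟨k', φ', h1', h2'⟩
      · have := h'.le
        omega
      · have h3 : Extends φ ψ' := h1'.trans (h2'.cancel h2)
        exact ih k (by omega) h1 h3

theorem Extends.addZero_addZero {n m : ℕ} {ψ : QState n} {φ : QState m} (h : Extends ψ φ) :
    Extends (StabCanon.addZero ψ) (StabCanon.addZero φ) := by
  induction h with
  | refl => exact .refl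
  | clifford _ hU ih =>
    rw [← opTensor_one_mulVec_addZero]
    exact ih.clifford (isClifford_opTensor hU .one)
  | smul _ ha ih =>
    rw [addZero_smul]
    exact ih.smul ha
  | addZero _ ih => exact ih.addZero

/-- Follows the construction of `χ`. When its last ancilla brings it to the size of `φ`, the last
ancilla of `φ` is stripped as well and the remainders are compared. -/
theorem Extends.amalgamate {n m l : ℕ} {ψ : QState n} {φ : QState m} {χ : QState l}
    (hφ : Extends ψ φ) (hχ : Extends ψ χ) (hml : m ≤ l) : Extends φ χ := by
  induction hχ generalizing m with
  | refl =>
    obtain rfl := le_antisymm hφ.le hml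
    exact hφ.symm
  | clifford _ hU ih => exact (ih hφ hml).clifford hU
  | smul _ ha ih => exact (ih hφ hml).smul ha
  | @addZero l χ hχ ih =>
    rcases hml.lt_or_eq with h | rfl
    · exact (ih hφ (by omega)).addZero
    · rcases hφ.symm_or with h | ⟨k, φ', h1, h2⟩
      · have := h.le
        have := hχ.le
        omega
      · have := h2.extends.le
        exact h2.extends_symm.trans (ih h1 (by omega)).addZero_addZero

/-- `CliffordEquiv ψ φ`: one of the states is an extension of the other. -/
def CliffordEquiv {n m : ℕ} (ψ : QState n) (φ : QState m) : Prop := Extends ψ φ ∨ Extends φ ψ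

/-- Going up and then down is cancellation of ancillas; going down and then up is amalgamation. -/
theorem CliffordEquiv.trans {n m l : ℕ} {ψ : QState n} {φ : QState m} {χ : QState l}
    (h : CliffordEquiv ψ φ) (h' : CliffordEquiv φ χ) : CliffordEquiv ψ χ := by
  rcases h with h | h <;> rcases h' with h' | h'
  · exact Or.inl (h.trans h')
  · rcases le_total n l with hl | hl
    · exact Or.inl (h'.cancel h hl)
    · exact Or.inr (h.cancel h' hl)
  · rcases le_total n l with hl | hl
    · exact Or.inl (h.amalgamate h' hl)
    · exact Or.inr (h'.amalgamate h hl)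
  · exact Or.inr (h'.trans h)

/-! ### Measurements commuting with the stabilizer. -/

/-- `MeasuresTo ψ χ`: the state `χ` is obtained from `ψ` by post-selected measurements of Pauli
operators that commute with the stabilizer of the measured state. -/
inductive MeasuresTo {n : ℕ} (ψ : QState n) : QState n → Prop
  | refl : MeasuresTo ψ ψ
  | measure {χ : QState n} {P : QOp n} (h : MeasuresTo ψ χ) (hP : IsPauliOperator P)
      (hcomm : ∀ Q ∈ stab χ, P * Q = Q * P) (h0 : pauliProj P *ᵥ χ ≠ 0) :
      MeasuresTo ψ (pauliProj P *ᵥ χ)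

theorem MeasuresTo.trans {n : ℕ} {ψ φ χ : QState n} (h : MeasuresTo ψ φ) (h' : MeasuresTo φ χ) :
    MeasuresTo ψ χ := by
  induction h' with
  | refl => exact h
  | measure _ hP hcomm h0 ih => exact ih.measure hP hcomm h0

theorem MeasuresTo.ne_zero {n : ℕ} {ψ χ : QState n} (h : MeasuresTo ψ χ) (hψ : ψ ≠ 0) :
    χ ≠ 0 := by
  cases h with
  | refl => exact hψ
  | measure _ _ _ h0 => exact h0

theorem conj_mul_conj {n : ℕ} {U : QOp n} (hU : IsClifford U) (P Q : QOp n) :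
    U * P * Uᴴ * (U * Q * Uᴴ) = U * (P * Q) * Uᴴ := by
  calc U * P * Uᴴ * (U * Q * Uᴴ) = U * P * (Uᴴ * U) * Q * Uᴴ := by simp only [mul_assoc]
    _ = U * (P * Q) * Uᴴ := by rw [hU.conjTranspose_mul_self, mul_one, mul_assoc U]

theorem pauliProj_conj {n : ℕ} {U : QOp n} (hU : IsClifford U) (P : QOp n) :
    pauliProj (U * P * Uᴴ) = U * pauliProj P * Uᴴ := by
  simp only [pauliProj, Matrix.mul_smul, Matrix.smul_mul, mul_add, add_mul, mul_one,
    hU.mul_conjTranspose_self]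

theorem MeasuresTo.clifford {n : ℕ} {ψ χ : QState n} (h : MeasuresTo ψ χ) {U : QOp n}
    (hU : IsClifford U) : MeasuresTo (U *ᵥ ψ) (U *ᵥ χ) := by
  induction h with
  | refl => exact .refl
  | @measure χ P _ hP hcomm h0 ih =>
    have heq : U *ᵥ (pauliProj P *ᵥ χ) = pauliProj (U * P * Uᴴ) *ᵥ (U *ᵥ χ) := by
      rw [pauliProj_conj hU, Matrix.mulVec_mulVec, Matrix.mulVec_mulVec, mul_assoc (U * _),
        hU.conjTranspose_mul_self, mul_one]
    rw [heq]
    refine ih.measure (.conj hU hP) ?_ (heq ▸ hU.mulVec_ne_zero h0)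
    intro Q hQ
    have hQ' := conj_mem_stab hU.conjTranspose hQ
    rw [hU.conjTranspose_mulVec_mulVec, Matrix.conjTranspose_conjTranspose] at hQ'
    have hQe : Q = U * (Uᴴ * Q * U) * Uᴴ := by
      have := conj_cancel (U := Uᴴ) (P := Q) (by
        rw [Matrix.conjTranspose_conjTranspose, hU.mul_conjTranspose_self])
      rw [Matrix.conjTranspose_conjTranspose] at this
      exact this.symm
    rw [hQe, conj_mul_conj hU, conj_mul_conj hU, hcomm _ hQ']

theorem MeasuresTo.smul {n : ℕ} {ψ χ : QState n} (h : MeasuresTo ψ χ) {a : ℂ} (ha : a ≠ 0) :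
    MeasuresTo (a • ψ) (a • χ) := by
  induction h with
  | refl => exact .refl
  | measure _ hP hcomm h0 ih =>
    rw [← Matrix.mulVec_smul]
    refine ih.measure hP (by rwa [stab_smul _ ha]) ?_
    rw [Matrix.mulVec_smul]
    exact smul_ne_zero ha h0

theorem pauliProj_opTensor_mulVec_addZero {n : ℕ} (P : QOp n) {a : Fin 4} (ha : a = 0 ∨ a = 3)
    (ψ : QState n) : pauliProj (opTensor P (pauliString fun _ : Fin 1 => a)) *ᵥ addZero ψ =
      addZero (pauliProj P *ᵥ ψ) := by
  simp only [pauliProj, Matrix.smul_mulVec, Matrix.add_mulVec, Matrix.one_mulVec,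
    opTensor_mulVec_addZero _ ha, addZero_smul]
  simp only [addZero, Matrix.mulVec_add]

theorem MeasuresTo.addZero {n : ℕ} {ψ χ : QState n} (h : MeasuresTo ψ χ) (hψ : ψ ≠ 0) :
    MeasuresTo (addZero ψ) (addZero χ) := by
  induction h with
  | refl => exact .refl
  | @measure χ P h hP hcomm h0 ih =>
    have heq := pauliProj_opTensor_mulVec_addZero P (Or.inl rfl) χ
    rw [← heq]
    refine ih.measure (isPauliOperator_opTensor hP (isPauliOperator_pauliString _)) ?_
      (heq ▸ addZero_ne_zero h0)
    intro Q hQ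
    obtain ⟨R, hR, a, ha, rfl⟩ := exists_of_mem_stab_addZero (h.ne_zero hψ) hQ
    rw [opTensor_mul, opTensor_mul, hcomm R hR, pauliString_zero, one_mul, mul_one]

/-- The commutation requirement includes `Z` on the ancilla. Each measured operator thus acts there
as `I` or `Z`, and measures only its other factor. -/
theorem MeasuresTo.of_addZero {n : ℕ} {ψ : QState n} {φ : QState (n + 1)}
    (h : MeasuresTo (StabCanon.addZero ψ) φ) :
    ∃ χ, MeasuresTo ψ χ ∧ φ = StabCanon.addZero χ := by
  induction h with
  | refl => exact ⟨ψ, .refl, rfl⟩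
  | @measure φ P _ hP hcomm h0 ih =>
    obtain ⟨χ, hχ, rfl⟩ := ih
    obtain ⟨Q, hQ, a, ha, rfl⟩ := exists_of_commute_zLast hP.1 (hcomm _ (zLast_mem_stab χ))
    rw [pauliProj_opTensor_mulVec_addZero Q ha] at h0 ⊢
    refine ⟨_, hχ.measure ⟨hQ, ?_⟩ ?_ fun h => h0 ?_, rfl⟩
    · have := hP.2.eq
      rw [opTensor_conjTranspose, pauliString_conjTranspose] at this
      exact opTensor_left_injective ha ha this
    · intro R hR
      have := hcomm _ (opTensor_mem_stab_addZero hR (Or.inl rfl))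
      rw [opTensor_mul, opTensor_mul, pauliString_zero, one_mul, mul_one] at this
      exact opTensor_left_injective ha ha this
    · rw [h]
      exact Matrix.mulVec_zero _

/-- Lets measurements be performed before the ancillas are added; `MeasuresTo.exists_extends_right`
is the converse exchange. Together they carry measurements across a Clifford equivalence. -/
theorem MeasuresTo.exists_extends_left {n m : ℕ} {ψ : QState n} {φ φ' : QState m}
    (hψ : Extends ψ φ) (h : MeasuresTo φ φ') : ∃ ψ', MeasuresTo ψ ψ' ∧ Extends ψ' φ' := by
  induction hψ with
  | refl => exact ⟨φ', h, .refl⟩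
  | @clifford m φ U _ hU ih =>
    have h1 := h.clifford hU.conjTranspose
    rw [hU.conjTranspose_mulVec_mulVec] at h1
    obtain ⟨ψ', h2, h3⟩ := ih h1
    have h4 := h3.clifford hU
    rw [hU.mulVec_conjTranspose_mulVec] at h4
    exact ⟨ψ', h2, h4⟩
  | @smul m φ a _ ha ih =>
    have h1 := h.smul (inv_ne_zero ha)
    rw [smul_smul, inv_mul_cancel₀ ha, one_smul] at h1
    obtain ⟨ψ', h2, h3⟩ := ih h1
    have h4 := h3.smul ha
    rw [smul_smul, mul_inv_cancel₀ ha, one_smul] at h4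
    exact ⟨ψ', h2, h4⟩
  | addZero _ ih =>
    obtain ⟨χ, hχ, rfl⟩ := h.of_addZero
    obtain ⟨ψ', h2, h3⟩ := ih hχ
    exact ⟨ψ', h2, h3.addZero⟩

theorem MeasuresTo.exists_extends_right {n m : ℕ} {ψ : QState n} {φ : QState m} {ψ' : QState n}
    (hψ : Extends ψ φ) (h0 : ψ ≠ 0) (h : MeasuresTo ψ ψ') :
    ∃ φ', MeasuresTo φ φ' ∧ Extends ψ' φ' := by
  induction hψ with
  | refl => exact ⟨ψ', h, .refl⟩
  | clifford _ hU ih =>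
    obtain ⟨φ', h2, h3⟩ := ih
    exact ⟨_, h2.clifford hU, h3.clifford hU⟩
  | smul _ ha ih =>
    obtain ⟨φ', h2, h3⟩ := ih
    exact ⟨_, h2.smul ha, h3.smul ha⟩
  | addZero hφ ih =>
    obtain ⟨φ', h2, h3⟩ := ih
    exact ⟨_, h2.addZero (hφ.ne_zero h0), h3.addZero⟩

/-- A post-selected Pauli measurement either commutes with the stabilizer of the state or acts
as a Clifford unitary. -/
theorem exists_measuresTo_extends {n : ℕ} {φ : QState n} {P : QOp n}
    (hP : IsPauliOperator P) (h : pauliProj P *ᵥ φ ≠ 0) :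
    ∃ χ, MeasuresTo φ χ ∧ Extends χ (pauliProj P *ᵥ φ) := by
  have hφ : φ ≠ 0 := by
    rintro rfl
    exact h (Matrix.mulVec_zero _)
  by_cases hc : ∀ Q ∈ stab φ, P * Q = Q * P
  · exact ⟨_, MeasuresTo.refl.measure hP hc h, .refl⟩
  · push Not at hc
    obtain ⟨Q, hQ, hPQ⟩ := hc
    have hQ' := isPauliOperator_of_mem_stab hφ hQ
    have hanti := (commute_or_of_mem_pauliGroup hP.1 hQ.1).resolve_left hPQ
    have h2 : ((√2 : ℝ) : ℂ)⁻¹ ≠ 0 := by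
      intro h0
      have := sqrt_two_inv_mul_self
      rw [h0] at this
      norm_num at this
    refine ⟨φ, .refl, ?_⟩
    -- Because `Qφ = φ`, the identity in `(1 + P)/2` may be replaced by `Q`.
    have : pauliProj P *ᵥ φ = ((√2 : ℝ) : ℂ)⁻¹ • (pauliSwap P Q *ᵥ φ) := by
      rw [pauliSwap, Matrix.smul_mulVec, smul_smul, sqrt_two_inv_mul_self, pauliProj,
        Matrix.smul_mulVec, Matrix.add_mulVec, Matrix.add_mulVec, hQ.2, Matrix.one_mulVec, add_comm]
    rw [this]
    exact (Extends.refl.clifford (pauliSwap_isClifford hP hQ' hanti)).smul h2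

/-! ### The invariant preserved by every circuit operation. -/

/-- `φ` is Clifford equivalent, up to ancilla qubits, to a state that `ψ` is measured to. -/
def Reaches {n m : ℕ} (ψ : QState n) (φ : QState m) : Prop :=
  ∃ χ, MeasuresTo ψ χ ∧ CliffordEquiv χ φ

theorem Reaches.ne_zero {n m : ℕ} {ψ : QState n} {φ : QState m} (h : Reaches ψ φ) (hψ : ψ ≠ 0) :
    φ ≠ 0 := by
  obtain ⟨χ, h1, h2 | h2⟩ := h
  · exact h2.ne_zero (h1.ne_zero hψ)
  · rintro rfl
    have key : ∀ {n m : ℕ} {ψ : QState n} {φ : QState m}, Extends ψ φ → ψ = 0 → φ = 0 := by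
      intro n m ψ φ h h0
      induction h with
      | refl => exact h0
      | clifford _ _ ih => rw [ih, Matrix.mulVec_zero]
      | smul _ _ ih => rw [ih, smul_zero]
      | addZero _ ih => rw [ih]; exact Matrix.mulVec_zero _
    exact h1.ne_zero hψ (key h2 rfl)

theorem Reaches.trans_cliffordEquiv {n m l : ℕ} {ψ : QState n} {φ : QState m} {χ : QState l}
    (h : Reaches ψ φ) (h' : CliffordEquiv φ χ) : Reaches ψ χ := by
  obtain ⟨ω, h1, h2⟩ := h
  exact ⟨ω, h1, h2.trans h'⟩

theorem Reaches.measure {n m : ℕ} {ψ : QState n} {φ : QState m} (h : Reaches ψ φ) (hψ : ψ ≠ 0)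
    {P : QOp m} (hP : IsPauliOperator P) (h0 : pauliProj P *ᵥ φ ≠ 0) :
    Reaches ψ (pauliProj P *ᵥ φ) := by
  have hφ := h.ne_zero hψ
  obtain ⟨χ, h1, h2⟩ := h
  obtain ⟨φ', h3, h4⟩ := exists_measuresTo_extends hP h0
  rcases h2 with h2 | h2
  · obtain ⟨χ', h5, h6⟩ := MeasuresTo.exists_extends_left h2 h3
    exact ⟨χ', h1.trans h5, CliffordEquiv.trans (Or.inl h6) (Or.inl h4)⟩
  · obtain ⟨χ', h5, h6⟩ := MeasuresTo.exists_extends_right h2 hφ h3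
    exact ⟨χ', h1.trans h5, CliffordEquiv.trans (Or.inr h6) (Or.inl h4)⟩

/-- The state of the empty register. -/
def emptyState : QState 0 := fun _ => 1

theorem emptyState_ne_zero : emptyState ≠ 0 := fun h => one_ne_zero (congrFun h default)

theorem eq_smul_emptyState (ψ : QState 0) : ψ = ψ default • emptyState := by
  funext x
  rw [Subsingleton.elim x default]
  simp [emptyState]

/-- A stabilizer of size `2 ^ (l + 1)` contains a non-scalar Pauli. A Clifford carries it to `Z` on
the last qubit, which then splits off as `|0⟩` and leaves a stabilizer of half the size. -/
theorem IsStabilizerState.extends {l : ℕ} {S : QState l} (hS : IsStabilizerState S) :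
    Extends emptyState S := by
  induction l with
  | zero =>
    rw [eq_smul_emptyState S]
    refine Extends.refl.smul fun h => hS.1 ?_
    rw [eq_smul_emptyState S, h, zero_smul]
  | succ l ih =>
    obtain ⟨P, hP, hP1⟩ := Set.exists_ne_of_one_lt_ncard
      (s := stab S) (by rw [hS.2]; exact Nat.one_lt_two_pow (Nat.succ_ne_zero l)) 1
    obtain ⟨D, hD, hDP, -⟩ := exists_clifford_transfer
      (isPauliOperator_of_mem_stab hS.1 hP) (zLast_isPauliOperator l)
      (fun a ha => hP1 (eq_one_of_mem_stab hS.1 hP ha)) zLast_ne_smul_one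
    obtain ⟨T, hT⟩ := exists_eq_addZero (ψ := D *ᵥ S) (by
      rw [Matrix.mulVec_mulVec, ← hDP, ← Matrix.mulVec_mulVec, hP.2])
    have hT0 : T ≠ 0 := by
      rintro rfl
      exact hD.mulVec_ne_zero hS.1 (hT.trans (Matrix.mulVec_zero _))
    have hcard : (stab T).ncard = 2 ^ l := by
      have := stab_clifford_ncard S hD
      rw [hT, stab_addZero_ncard hT0, hS.2, pow_succ'] at this
      omega
    have h1 := (ih ⟨hT0, hcard⟩).addZero.clifford hD.conjTranspose
    rwa [← hT, hD.conjTranspose_mulVec_mulVec] at h1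

theorem tensor_smul_right {m l n : ℕ} (h : m + l = n) (ψ : QState m) (a : ℂ) (φ : QState l) :
    tensor h ψ (a • φ) = a • tensor h ψ φ := by
  funext x
  simp [tensor, mul_left_comm]

theorem tensor_emptyState {m : ℕ} (ψ : QState m) : tensor rfl ψ emptyState = ψ := by
  funext x
  simp only [tensor, emptyState, mul_one]
  rfl

theorem addZero_apply {n : ℕ} (ψ : QState n) (x : Fin (n + 1) → Fin 2) :
    addZero ψ x = if x (Fin.last n) = 0 then ψ (fun i => x i.castSucc) else 0 := by
  obtain ⟨u, v, rfl⟩ := exists_eq_append x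
  rw [addZero_append]
  have h1 : Fin.append u v (Fin.last n) = v 0 := Fin.append_right u v 0
  have h2 : (fun i => Fin.append u v (Fin.castSucc i)) = u :=
    funext fun i => Fin.append_left u v i
  rw [h1, h2]
  rcases fin_one_fun_eq v with rfl | rfl <;> simp [one_ne_zero_fun]

theorem tensor_addZero {m l : ℕ} (ψ : QState m) (φ : QState l) :
    tensor (m := m) (l := l + 1) (n := m + l + 1) rfl ψ (addZero φ) =
      addZero (tensor (m := m) (l := l) (n := m + l) rfl ψ φ) := by
  funext x
  simp only [tensor, addZero_apply]
  rw [mul_ite, mul_zero]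
  rfl

theorem Extends.tensor {m l k : ℕ} {φ : QState l} {χ : QState k} (ψ : QState m)
    (h : Extends φ χ) :
    Extends (StabCanon.tensor rfl ψ φ) (StabCanon.tensor rfl ψ χ) := by
  induction h with
  | refl => exact .refl
  | @clifford k χ U _ hU ih =>
    have h1 := opTensor_mulVec 1 U ψ χ
    rw [Matrix.one_mulVec] at h1
    rw [← h1]
    exact ih.clifford (isClifford_opTensor .one hU)
  | smul _ ha ih =>
    rw [tensor_smul_right]
    exact ih.smul ha
  | @addZero k χ _ ih =>
    have := tensor_addZero ψ χ
    exact this ▸ ih.addZero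

theorem IsStabilizerState.extends_tensor {m l : ℕ} {S : QState l} (hS : IsStabilizerState S)
    (ψ : QState m) : Extends ψ (tensor rfl ψ S) := by
  have := hS.extends.tensor ψ
  rwa [tensor_emptyState] at this

theorem tensor_ne_zero {m l : ℕ} {ψ : QState m} {φ : QState l} (hψ : ψ ≠ 0) (hφ : φ ≠ 0) :
    tensor rfl ψ φ ≠ 0 := by
  obtain ⟨u, hu⟩ := Function.ne_iff.1 hψ
  obtain ⟨v, hv⟩ := Function.ne_iff.1 hφ
  intro h
  have := congrFun h (Fin.append u v)
  rw [tensor_append] at this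
  exact mul_ne_zero hu hv this

theorem pauliProj_zLast_mulVec {n : ℕ} (ψ : QState (n + 1)) :
    pauliProj (zLast n) *ᵥ ψ = addZero ((zeroIsometry n)ᴴ *ᵥ ψ) := by
  rw [addZero, Matrix.mulVec_mulVec, zeroIsometry_mul_conjTranspose]

theorem pauliProj_opTensor_one_mulVec {m l : ℕ} (Q : QOp l) (ψ : QState m) (φ : QState l) :
    pauliProj (opTensor 1 Q) *ᵥ tensor rfl ψ φ = tensor rfl ψ (pauliProj Q *ᵥ φ) := by
  have h : pauliProj (opTensor (1 : QOp m) Q) = opTensor 1 (pauliProj Q) := by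
    rw [pauliProj, pauliProj, opTensor_smul_right, ← opTensor_one]
    congr 1
    ext x y
    simp [opTensor, mul_add]
  rw [h, opTensor_mulVec, Matrix.one_mulVec]

/-- The discarded `ρ` need not be a stabilizer state. Measuring `Z` on its last qubit leaves `φ`
untouched and turns that qubit into a `|0⟩` ancilla, which the equivalence forgets. -/
theorem Reaches.of_tensor {n m l : ℕ} {ψ : QState n} (hψ : ψ ≠ 0) {φ : QState m} {ρ : QState l}
    (h : Reaches ψ (tensor rfl φ ρ)) : Reaches ψ φ := by
  have h0 := h.ne_zero hψ
  have hφ : φ ≠ 0 := by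
    rintro rfl
    exact h0 (by funext x; simp [tensor])
  have hρ : ρ ≠ 0 := by
    rintro rfl
    exact h0 (by funext x; simp [tensor])
  clear h0
  induction l with
  | zero =>
    rw [eq_smul_emptyState ρ, tensor_smul_right, tensor_emptyState] at h
    refine h.trans_cliffordEquiv (Or.inr (Extends.refl.smul fun h0 => hρ ?_))
    rw [eq_smul_emptyState ρ, h0, zero_smul]
  | succ l ih =>
    have key : ∀ ρ : QState (l + 1), pauliProj (zLast l) *ᵥ ρ ≠ 0 →
        Reaches ψ (tensor rfl φ ρ) → Reaches ψ φ := by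
      intro ρ hρ h
      have h1 := pauliProj_opTensor_one_mulVec (zLast l) φ ρ
      have h2 := h.measure hψ (isPauliOperator_opTensor .one (zLast_isPauliOperator l))
        (h1 ▸ tensor_ne_zero hφ hρ)
      rw [h1] at h2
      rw [pauliProj_zLast_mulVec] at h2 hρ
      rw [tensor_addZero] at h2
      exact ih (h2.trans_cliffordEquiv (Or.inr Extends.refl.addZero)) fun h3 => hρ (by
        rw [h3]; exact Matrix.mulVec_zero _)
    by_cases hz : pauliProj (zLast l) *ᵥ ρ = 0
    -- Outcome `+1` is impossible here, so `ρ` is a `-1` eigenvector of `Z`. A Pauli anticommuting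
    -- with `Z` turns it into a `+1` eigenvector.
    · obtain ⟨R, hR, hZR⟩ := exists_anticommute (zLast_isPauliOperator l).1 zLast_ne_smul_one
      have hRc := IsClifford.of_mem_pauliGroup hR
      refine key (R *ᵥ ρ) ?_ ?_
      · have h1 : zLast l *ᵥ ρ = -ρ := by
          have h2 := congrArg (fun v => (2 : ℂ) • v) hz
          simp only [pauliProj, Matrix.smul_mulVec, Matrix.add_mulVec, Matrix.one_mulVec, smul_zero,
            smul_smul] at h2
          norm_num at h2
          exact (neg_eq_of_add_eq_zero_right h2).symm
        have h2 : zLast l *ᵥ (R *ᵥ ρ) = R *ᵥ ρ := by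
          rw [Matrix.mulVec_mulVec, hZR, Matrix.neg_mulVec, ← Matrix.mulVec_mulVec, h1,
            Matrix.mulVec_neg, neg_neg]
        rw [((pauliProj_spec (zLast_isPauliOperator l)).2.2 _).1 h2]
        exact hRc.mulVec_ne_zero hρ
      · have h1 := opTensor_mulVec 1 R φ ρ
        rw [Matrix.one_mulVec] at h1
        rw [← h1]
        exact h.trans_cliffordEquiv
          (Or.inl (Extends.refl.clifford (isClifford_opTensor .one hRc)))
    · exact key ρ hz h

theorem StabCircuit.Maps.reaches {n m : ℕ} {ψ : QState n} (hψ : ψ ≠ 0) {c : StabCircuit n m}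
    {φ : QState m} (h : c.Maps ψ φ) : Reaches ψ φ := by
  induction c with
  | idle =>
    obtain rfl : φ = ψ := h
    exact ⟨φ, .refl, Or.inl .refl⟩
  | clifford c U hU ih =>
    obtain ⟨χ, h1, rfl⟩ := h
    exact (ih h1).trans_cliffordEquiv (Or.inl (Extends.refl.clifford hU))
  | measure c P hP ih =>
    obtain ⟨χ, h1, rfl, h0⟩ := h
    exact (ih h1).measure hψ hP h0
  | ancilla c S hS ih =>
    obtain ⟨χ, h1, rfl⟩ := h
    exact (ih h1).trans_cliffordEquiv (Or.inl (hS.extends_tensor χ))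
  | discard c ih =>
    obtain ⟨χ, h1, ρ, rfl⟩ := h
    exact (ih h1).of_tensor hψ

/-! ### From the invariant to the canonical form. -/

theorem nullity_emptyState : nullity emptyState = 0 := by
  have : stab emptyState = {1} := by
    refine Set.eq_singleton_iff_unique_mem.2 ⟨one_mem_stab _, fun P hP => ?_⟩
    obtain ⟨k, p, rfl⟩ := mem_pauliGroup_iff.1 hP.1
    refine eq_one_of_mem_stab emptyState_ne_zero hP (a := Complex.I ^ k) ?_
    rw [Subsingleton.elim p fun _ => 0, pauliString_zero]
  rw [nullity, this]
  simp

theorem Extends.isStabilizerState {l : ℕ} {S : QState l} (h : Extends emptyState S) :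
    IsStabilizerState S := by
  refine ⟨h.ne_zero emptyState_ne_zero, ?_⟩
  have h1 := h.nullity_eq emptyState_ne_zero
  rw [nullity_emptyState, nullity, sub_eq_zero, eq_comm,
    Real.logb_eq_iff_rpow_eq two_pos (by norm_num) (Nat.cast_pos.2 (Nat.pos_of_ne_zero
      (Set.ncard_ne_zero_of_mem (one_mem_stab S) (stab_finite S)))), Real.rpow_natCast] at h1
  exact_mod_cast h1.symm

theorem Extends.exists_tensor_eq {n m : ℕ} {φ : QState m} {χ : QState n} (h : Extends φ χ) :
    ∃ (l : ℕ) (hl : m + l = n) (S : QState l), IsStabilizerState S ∧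
      ∃ C : QOp n, IsClifford C ∧ Proportional (StabCanon.tensor hl φ S) (C *ᵥ χ) := by
  -- As an extension of the empty state, `S` takes a further `|0⟩` directly in the induction.
  suffices ∃ (l : ℕ) (hl : m + l = n) (S : QState l), Extends emptyState S ∧
      ∃ C : QOp n, IsClifford C ∧ Proportional (StabCanon.tensor hl φ S) (C *ᵥ χ) by
    obtain ⟨l, hl, S, hS, h⟩ := this
    exact ⟨l, hl, S, hS.isStabilizerState, h⟩
  induction h with
  | refl =>
    refine ⟨0, rfl, emptyState, .refl, 1, .one, 1, one_ne_zero, ?_⟩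
    rw [one_smul, Matrix.one_mulVec]
    exact tensor_emptyState φ
  | @clifford n χ U _ hU ih =>
    obtain ⟨l, hl, S, hS, C, hC, a, ha, h⟩ := ih
    refine ⟨l, hl, S, hS, C * Uᴴ, hC.mul hU.conjTranspose, a, ha, ?_⟩
    rw [← Matrix.mulVec_mulVec, hU.conjTranspose_mulVec_mulVec, h]
  | @smul n χ b _ hb ih =>
    obtain ⟨l, hl, S, hS, C, hC, a, ha, h⟩ := ih
    refine ⟨l, hl, S, hS, C, hC, a * b⁻¹, mul_ne_zero ha (inv_ne_zero hb), ?_⟩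
    rw [Matrix.mulVec_smul, smul_smul, mul_assoc, inv_mul_cancel₀ hb, mul_one, h]
  | @addZero n χ _ ih =>
    obtain ⟨l, rfl, S, hS, C, hC, a, ha, h⟩ := ih
    refine ⟨l + 1, rfl, _, hS.addZero, opTensor C (1 : QOp 1), isClifford_opTensor hC .one, a,
      ha, ?_⟩
    rw [opTensor_one_mulVec_addZero, ← addZero_smul, ← h]
    exact tensor_addZero φ S

theorem MeasuresTo.stab_subset {n : ℕ} {ψ χ : QState n} (h : MeasuresTo ψ χ) :
    stab ψ ⊆ stab χ := by
  induction h with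
  | refl => exact subset_rfl
  | @measure χ P _ hP hcomm _ ih =>
    intro Q hQ
    have hQ' := ih hQ
    refine ⟨hQ.1, ?_⟩
    have h1 : Q * pauliProj P = pauliProj P * Q := by
      rw [pauliProj, Matrix.mul_smul, Matrix.smul_mul, mul_add, add_mul, mul_one, one_mul,
        hcomm Q hQ']
    rw [Matrix.mulVec_mulVec, h1, ← Matrix.mulVec_mulVec, hQ'.2]

theorem mul_pauliProj_self {n : ℕ} {P : QOp n} (hP : IsPauliOperator P) :
    P * pauliProj P = pauliProj P := by
  rw [pauliProj, Matrix.mul_smul, mul_add, mul_one, hP.mul_self, add_comm]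

theorem mul_pauliProj_of_mul_eq {n : ℕ} {A P : QOp n} (h : A * P = A) : A * pauliProj P = A := by
  rw [pauliProj, Matrix.mul_smul, mul_add, mul_one, h]
  module

/-- Stabilizers only grow, so every measured operator ends up in `Stab χ`, and `A` absorbs its
projector. -/
theorem MeasuresTo.mulVec_eq {n : ℕ} {ψ χ : QState n} (h : MeasuresTo ψ χ) {A : QOp n}
    (hA : ∀ Q ∈ stab χ, A * Q = A) : A *ᵥ ψ = A *ᵥ χ := by
  induction h with
  | refl => rfl
  | @measure χ P h hP hcomm h0 ih =>
    have hsub := (MeasuresTo.refl.measure hP hcomm h0).stab_subset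
    have hPmem : P ∈ stab (pauliProj P *ᵥ χ) :=
      ⟨hP.1, by rw [Matrix.mulVec_mulVec, mul_pauliProj_self hP]⟩
    rw [ih fun Q hQ => hA Q (hsub hQ), Matrix.mulVec_mulVec,
      mul_pauliProj_of_mul_eq (hA P hPmem)]

/-- The average of the group `Stab χ`: multiplication by an element permutes the summands. -/
theorem exists_stab_average {n : ℕ} {χ : QState n} (hχ : χ ≠ 0) :
    ∃ A : QOp n, (∀ Q ∈ stab χ, A * Q = A) ∧
      ∀ φ : QState n, (∀ Q ∈ stab χ, Q *ᵥ φ = φ) → A *ᵥ φ = φ := by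
  have hfin := stab_finite χ
  refine ⟨((stab χ).ncard : ℂ)⁻¹ • ∑ Q ∈ hfin.toFinset, Q, fun Q hQ => ?_, fun φ hφ => ?_⟩
  · have hQQ := (isPauliOperator_of_mem_stab hχ hQ).mul_self
    rw [Matrix.smul_mul, Finset.sum_mul]
    congr 1
    refine Finset.sum_nbij' (fun R => R * Q) (fun R => R * Q) ?_ ?_ ?_ ?_ ?_
    · intro R hR
      rw [Set.Finite.mem_toFinset] at hR ⊢
      exact mul_mem_stab hR hQ
    · intro R hR
      rw [Set.Finite.mem_toFinset] at hR ⊢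
      exact mul_mem_stab hR hQ
    · intro R _
      rw [mul_assoc, hQQ, mul_one]
    · intro R _
      rw [mul_assoc, hQQ, mul_one]
    · intro R _
      rfl
  · have h0 : ((stab χ).ncard : ℂ) ≠ 0 :=
      Nat.cast_ne_zero.2 (Set.ncard_ne_zero_of_mem (one_mem_stab χ) hfin)
    rw [Matrix.smul_mulVec, Matrix.sum_mulVec, Finset.sum_congr rfl fun Q hQ =>
      hφ Q ((Set.Finite.mem_toFinset hfin).1 hQ), Finset.sum_const,
      ← Set.ncard_eq_toFinset_card _ hfin, ← Nat.cast_smul_eq_nsmul ℂ, smul_smul,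
      inv_mul_cancel₀ h0, one_smul]

/-- A subgroup `K` of an elementary abelian `2`-group `H` of operators has a complement with
a basis `P`. -/
theorem exists_basis_of_involutions {n : ℕ} {H : Set (QOp n)} (hfin : H.Finite)
    (hmul : ∀ P ∈ H, ∀ Q ∈ H, P * Q ∈ H) (hsq : ∀ P ∈ H, P * P = 1)
    (hcomm : ∀ P ∈ H, ∀ Q ∈ H, P * Q = Q * P) {K : Set (QOp n)} (hKH : K ⊆ H)
    (hK1 : 1 ∈ K) (hKmul : ∀ P ∈ K, ∀ Q ∈ K, P * Q ∈ K) :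
    ∃ (k : ℕ) (P : Fin k → QOp n), (∀ i, P i ∈ H) ∧ H.ncard = 2 ^ k * K.ncard ∧
      (∀ s : Finset (Fin k), s.Nonempty →
        (List.ofFn fun i => if i ∈ s then P i else 1).prod ∉ K) ∧
      ∀ φ : QState n, (∀ Q ∈ K, Q *ᵥ φ = φ) → (∀ i, P i *ᵥ φ = φ) → ∀ Q ∈ H, Q *ᵥ φ = φ := by
  by_cases hKeq : K = H
  · subst hKeq
    refine ⟨0, Fin.elim0, fun i => i.elim0, by simp, fun s hs => ?_, fun φ h _ => h⟩
    obtain ⟨i, -⟩ := hs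
    exact i.elim0
  · obtain ⟨R, hRH, hRK⟩ := Set.exists_of_ssubset (hKH.ssubset_of_ne hKeq)
    have hRR := hsq R hRH
    have hinj : Function.Injective fun Q => R * Q := fun P Q h => by
      have := congrArg (fun A => R * A) h
      simpa only [← mul_assoc, hRR, one_mul] using this
    have hdisj : Disjoint K ((fun Q => R * Q) '' K) := by
      rw [Set.disjoint_left]
      rintro _ hQ ⟨Q, hQ', rfl⟩
      apply hRK
      have := hKmul _ hQ _ hQ'
      rwa [mul_assoc, hsq Q (hKH hQ'), mul_one] at this
    -- Adjoining `R` doubles `K`; the recursion then treats `K'` inside `H`.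
    set K' := K ∪ (fun Q => R * Q) '' K with hK'
    have hK'H : K' ⊆ H := by
      refine Set.union_subset hKH ?_
      rintro _ ⟨Q, hQ, rfl⟩
      exact hmul R hRH Q (hKH hQ)
    have hcard : K'.ncard = 2 * K.ncard := by
      rw [hK', Set.ncard_union_eq hdisj (hfin.subset hKH) ((hfin.subset hKH).image _),
        Set.ncard_image_of_injective _ hinj, two_mul]
    have hdec : H.ncard - K'.ncard < H.ncard - K.ncard := by
      have h1 := Set.ncard_le_ncard hK'H hfin
      have h2 := (Set.ncard_pos (hfin.subset hKH)).2 ⟨1, hK1⟩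
      omega
    have hK'mul : ∀ P ∈ K', ∀ Q ∈ K', P * Q ∈ K' := by
      rintro P (hP | ⟨P, hP, rfl⟩) Q (hQ | ⟨Q, hQ, rfl⟩)
      · exact Or.inl (hKmul _ hP _ hQ)
      · refine Or.inr ⟨P * Q, hKmul _ hP _ hQ, ?_⟩
        simp only [← mul_assoc]
        rw [hcomm P (hKH hP) R hRH]
      · exact Or.inr ⟨P * Q, hKmul _ hP _ hQ, (mul_assoc _ _ _).symm⟩
      · left
        have : R * P * (R * Q) = P * Q := by
          rw [hcomm R hRH P (hKH hP), mul_assoc, ← mul_assoc R, hRR, one_mul]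
        simp only [this]
        exact hKmul _ hP _ hQ
    obtain ⟨k, P, hPH, hPcard, hPind, hPgen⟩ :=
      exists_basis_of_involutions hfin hmul hsq hcomm hK'H (Or.inl hK1) hK'mul
    refine ⟨k + 1, Fin.cons R P, ?_, ?_, ?_, ?_⟩
    · intro i
      refine Fin.cases hRH (fun j => ?_) i
      exact hPH j
    · rw [hPcard, hcard, pow_succ, mul_assoc]
    · intro s hs hmem
      rw [List.ofFn_succ, List.prod_cons] at hmem
      simp only [Fin.cons_zero, Fin.cons_succ] at hmem
      set t : Finset (Fin k) := Finset.univ.filter fun i => Fin.succ i ∈ s with ht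
      have htmem : ∀ i, Fin.succ i ∈ s ↔ i ∈ t := fun i => by simp [ht]
      simp only [htmem] at hmem
      -- `t` is the part of `s` beyond `R`. If it is non-empty, a factor `R` is absorbed by `K'` and
      -- independence modulo `K'` applies; otherwise the product is `R`, which is not in `K`.
      by_cases htne : t.Nonempty
      · refine hPind t htne ?_
        split_ifs at hmem
        · refine Or.inr ⟨_, hmem, ?_⟩
          simp only [← mul_assoc, hRR, one_mul]
        · rw [one_mul] at hmem
          exact Or.inl hmem
      · rw [Finset.not_nonempty_iff_eq_empty] at htne
        have h0 : (0 : Fin (k + 1)) ∈ s := by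
          obtain ⟨i, hi⟩ := hs
          refine Fin.cases (fun h => h) (fun j h => ?_) i hi
          have := (htmem j).1 h
          rw [htne] at this
          exact absurd this (Finset.notMem_empty j)
        rw [htne, if_pos h0] at hmem
        simp only [Finset.notMem_empty, if_false, List.ofFn_const, List.prod_replicate, one_pow,
          mul_one] at hmem
        exact hRK hmem
    · intro φ hφ hPφ
      refine hPgen φ ?_ fun i => hPφ i.succ
      have hRφ : R *ᵥ φ = φ := hPφ 0
      rintro _ (hQ | ⟨Q, hQ, rfl⟩)
      · exact hφ _ hQ
      · rw [← Matrix.mulVec_mulVec, hφ Q hQ, hRφ]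
termination_by H.ncard - K.ncard

theorem commute_list_prod {M : Type*} [Monoid M] {A : M} {L : List M}
    (h : ∀ B ∈ L, A * B = B * A) : A * L.prod = L.prod * A :=
  Commute.list_prod_right L A h

theorem mul_list_prod_of_mem {M : Type*} [Monoid M] {A B : M} {L : List M} (hB : B ∈ L)
    (hAB : A * B = B) (h : ∀ B ∈ L, A * B = B * A) : A * L.prod = L.prod := by
  obtain ⟨L₁, L₂, rfl⟩ := List.append_of_mem hB
  have h1 : A * L₁.prod = L₁.prod * A :=
    commute_list_prod fun B hB => h B (List.mem_append_left _ hB)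
  rw [List.prod_append, List.prod_cons, ← mul_assoc, h1, mul_assoc, ← mul_assoc A, hAB]

theorem list_prod_absorb {M : Type*} [Monoid M] {A : M} {L : List M}
    (h : ∀ B ∈ L, A * B = A) : A * L.prod = A := by
  induction L with
  | nil => simp
  | cons B L ih =>
    rw [List.prod_cons, ← mul_assoc, h B List.mem_cons_self,
      ih fun C hC => h C (List.mem_cons_of_mem _ hC)]

/-- The operators actually measured may be redundant, so they are replaced by a basis of `Stab χ`
modulo `Stab ψ`, whose size is the drop in nullity. -/
theorem MeasuresTo.exists_pauliProj_prod {n : ℕ} {ψ χ : QState n} (h : MeasuresTo ψ χ)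
    (hψ : ψ ≠ 0) : ∃ (k : ℕ) (P : Fin k → QOp n), (k : ℝ) = nullity ψ - nullity χ ∧
      (∀ i, IsPauliOperator (P i)) ∧ (∀ i j, Commute (P i) (P j)) ∧ PauliIndependent P ∧
      (List.ofFn fun i => pauliProj (P i)).prod *ᵥ ψ = χ := by
  have hχ := h.ne_zero hψ
  have hH : ∀ P ∈ stab χ, IsPauliOperator P := fun P => isPauliOperator_of_mem_stab hχ
  have hcomm : ∀ P ∈ stab χ, ∀ Q ∈ stab χ, P * Q = Q * P :=
    fun P hP Q hQ => commute_of_mem_stab hχ hP hQ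
  obtain ⟨k, P, hPH, hcard, hind, hgen⟩ := exists_basis_of_involutions (stab_finite χ)
    (fun P hP Q hQ => mul_mem_stab hP hQ) (fun P hP => (hH P hP).mul_self) hcomm h.stab_subset
    (one_mem_stab ψ) (fun P hP Q hQ => mul_mem_stab hP hQ)
  have hcomm' : ∀ Q ∈ stab χ, ∀ B ∈ List.ofFn fun i => pauliProj (P i), Q * B = B * Q := by
    intro Q hQ B hB
    obtain ⟨i, rfl⟩ := (List.mem_ofFn' _ _).1 hB
    change Q * pauliProj (P i) = pauliProj (P i) * Q
    rw [pauliProj, Matrix.mul_smul, Matrix.smul_mul, mul_add, add_mul, mul_one, one_mul,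
      hcomm Q hQ _ (hPH i)]
  refine ⟨k, P, ?_, fun i => hH _ (hPH i), fun i j => hcomm _ (hPH i) _ (hPH j), ?_, ?_⟩
  · have h0 : ((stab ψ).ncard : ℝ) ≠ 0 :=
      Nat.cast_ne_zero.2 (Set.ncard_ne_zero_of_mem (one_mem_stab ψ) (stab_finite ψ))
    rw [nullity, nullity, hcard]
    push_cast
    rw [Real.logb_mul (by positivity) h0, Real.logb_pow, Real.logb_self_eq_one (by norm_num)]
    ring
  · intro s hs a ha
    have hmem : (List.ofFn fun i => if i ∈ s then P i else 1).prod ∈ stab χ := by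
      refine List.prod_induction (· ∈ stab χ) (fun P Q hP hQ => mul_mem_stab hP hQ)
        (one_mem_stab χ) ?_
      intro B hB
      obtain ⟨i, rfl⟩ := (List.mem_ofFn' _ _).1 hB
      dsimp only
      split_ifs
      · exact hPH i
      · exact one_mem_stab χ
    apply hind s hs
    rw [eq_one_of_mem_stab hχ hmem ha]
    exact one_mem_stab ψ
  · obtain ⟨A, hA, hfix⟩ := exists_stab_average hχ
    set T := (List.ofFn fun i => pauliProj (P i)).prod *ᵥ ψ with hT
    have hTfix : ∀ Q ∈ stab χ, Q *ᵥ T = T := by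
      refine hgen T (fun Q hQ => ?_) fun i => ?_
      · rw [hT, Matrix.mulVec_mulVec, commute_list_prod (hcomm' Q (h.stab_subset hQ)),
          ← Matrix.mulVec_mulVec, hQ.2]
      · rw [hT, Matrix.mulVec_mulVec, mul_list_prod_of_mem
          ((List.mem_ofFn' _ _).2 ⟨i, rfl⟩) (mul_pauliProj_self (hH _ (hPH i)))
          (hcomm' _ (hPH i))]
    -- With `A` the average over `Stab χ`: `T = A T = A ψ = A χ = χ`, the second equality because
    -- `A` absorbs the projectors in `T`.
    rw [← hfix T hTfix, hT, Matrix.mulVec_mulVec, list_prod_absorb, h.mulVec_eq hA,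
      hfix χ fun Q hQ => hQ.2]
    intro B hB
    obtain ⟨i, rfl⟩ := (List.mem_ofFn' _ _).1 hB
    exact mul_pauliProj_of_mul_eq (hA _ (hPH i))

end StabCanon

end

theorem mainTheorem2 {n m : ℕ} (hmn : m ≤ n)
    (ψin : StabCanon.QState n) (ψout : StabCanon.QState m) (hin : ψin ≠ 0)
    (circ : StabCanon.StabCircuit n m) (hcirc : circ.HasOutput ψin ψout) :
    ∃ k : ℕ, (k : ℝ) = StabCanon.nullity ψin - StabCanon.nullity ψout ∧
      ∃ P : Fin k → StabCanon.QOp n,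
        (∀ i, StabCanon.IsPauliOperator (P i)) ∧
        (∀ i j, Commute (P i) (P j)) ∧
        StabCanon.PauliIndependent P ∧
        ∃ C : StabCanon.QOp n, StabCanon.IsClifford C ∧
          ∃ S : StabCanon.QState (n - m), StabCanon.IsStabilizerState S ∧
            StabCanon.Proportional
              (StabCanon.tensor (Nat.add_sub_of_le hmn) ψout S)
              (Matrix.mulVec (C * (List.ofFn fun i => StabCanon.pauliProj (P i)).prod) ψin) := by
  obtain ⟨φ, hφ, a, ha, rfl⟩ := hcirc
  have hreach := (StabCanon.StabCircuit.Maps.reaches hin hφ).trans_cliffordEquiv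
    (Or.inl (StabCanon.Extends.refl.smul ha))
  have hout := hreach.ne_zero hin
  obtain ⟨χ, hχ, hequiv⟩ := hreach
  -- If instead the output extends `χ`, then `n ≤ m`. The sizes agree and the extension is
  -- reversible.
  have hext : StabCanon.Extends (a • φ) χ := by
    rcases hequiv with h | h
    · obtain rfl := le_antisymm hmn h.le
      exact h.symm
    · exact h
  obtain ⟨k, P, hk, hP, hcomm, hind, hprod⟩ := hχ.exists_pauliProj_prod hin
  obtain ⟨l, hl, S, hS, C, hC, hprop⟩ := hext.exists_tensor_eq
  obtain rfl : l = n - m := by omega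
  refine ⟨k, by rw [hk, hext.nullity_eq hout], P, hP, hcomm, hind, C, hC, S, hS, ?_⟩
  rw [← Matrix.mulVec_mulVec, hprod]
  exact hprop
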